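/- Fix dimensions $k_v,k_w,k_\gamma,k_f$. For every pair of sample sizes $(N,T)$ let a probability space with a sub-$\sigma$-algebra $\mathcal F$ be given (everything may depend on $(N,T)$; this is suppressed in the notation), together with random vectors $v_s\in\mathbb R^{k_v}$ and $w_{st}\in\mathbb R^{k_w}$ ($1\le s,t\le T$), real random variables $e_{it}$ and non-random vectors $\gamma_i\in\mathbb R^{k_\gamma}$ ($1\le i\le N$). Write $e_t=(e_{1t},\dots,e_{Nt})'$, let $\|\cdot\|$ be the Euclidean norm of a vector or the operator norm of a matrix, let all limits be joint limits as $N,T\to\infty$ (without restriction on the rates), and let $C$ be a generic constant independent of $N,T$. Put $$\xi_i=\begin{pmatrix}\frac1{\sqrt T}\sum_{s=1}^T(\gamma_i\otimes v_s)\,e_{is}\\[2pt] \frac1T\sum_{s=1}^T\sum_{t<s}w_{st}e_{it}e_{is}\end{pmatrix}.$$ Assume the following. (A1) All $v_s,w_{st}$ are $\mathcal F$-measurable; $\frac1T\sum_s\mathbb E(v_sv_s')\to\Omega_v$ and $\frac1{T^2}\sum_s\sum_{t<s}\mathbb E(w_{st}w_{st}')\to\Omega_w$ with $\Omega_v,\Omega_w$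 of full rank; $\max_{s}\mathbb E\|v_s\|^4<C$ and $\max_{s,t}\mathbb E\|w_{st}\|^4<C$; $\mathbb E\big\|\frac1{T^2}\sum_s\sum_{t<s}(w_{st}w_{st}'-\mathbb E w_{st}w_{st}')\big\|^2\to0$ and $\mathbb E\big\|\frac1T\sum_s(v_sv_s'-\mathbb E v_sv_s')\big\|^2\to0$. (A2) $\max_i\|\gamma_i\|<C$. (A3) Conditionally on $\mathcal F$ the vectors $e_1,\dots,e_T$ are independent, $\mathbb E(e_t|\mathcal F)=0$, and $\max_{i,t}\mathbb E(e_{it}^4)<C$. (A4) $e_{it}=\pi_i'f_t+\eta_{it}$ with non-random $\pi_i\in\mathbb R^{k_f}$, random vectors $f_t\in\mathbb R^{k_f}$ and random variables $\eta_{it}$ such that: (i) conditionally on $\mathcal F$ the $f_t$ are independent, $\mathbb E(f_t|\mathcal F)=0$, $\mathbb E(f_tf_t')=I_{k_f}$, $\max_{s,t}\mathbb E[(\|v_s\|^4+1)\|f_t\|^4]<C$, $\max_{s,t,t^*}\mathbb E[\|w_{st^*}\|^4\|f_t\|^8]<C$; (ii) the largest eigenvalue of $\sum_{i=1}^N\pi_i\pi_i'$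 is less than $C$, and $\frac1{\sqrt N}\sum_{i=1}^N\pi_i\gamma_i'\to\Gamma_{\pi\gamma}$; (iii) the $\eta_{it}$ are mutually independent over $(i,t)$, and jointly independent of $\mathcal F$ and $(f_s)_s$, with mean zero and variances $\mathrm{var}(\eta_{it})=\omega_i^2<C$ such that $\frac1N\sum_i\omega_i^4\to\omega^4$, $\frac1N\sum_i\omega_i^2\gamma_i\gamma_i'\to\Gamma_\omega$ with $\Gamma_\omega$ of full rank, and $\max_{i,t}\mathbb E(\eta_{it}^4)<C$; (iv) if $\Gamma_{\pi\gamma}\ne0$, then $\mathbb E\big\|\frac1T\sum_s(f_sf_s')\otimes(v_sv_s')-\Sigma_{fv}\big\|^2\to0$ for a matrix $\Sigma_{fv}$. Let $$\Sigma_\xi=\begin{pmatrix}\Sigma_V&0\\0&\Sigma_W\end{pmatrix},\qquad \Sigma_W=\omega^4\Omega_w,\qquad \Sigma_V=(\Gamma_{\pi\gamma}'\otimes I_{k_v})\Sigma_{fv}(\Gamma_{\pi\gamma}\otimes I_{k_v})+\Gamma_\omega\otimes\Omega_v,$$ where the first summand of $\Sigma_V$ is $0$ if $\Gamma_{\pi\gamma}=0$.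 If in addition $\Gamma_{\pi\gamma}=0$, then $$\frac1N\sum_{i=1}^N\xi_i\xi_i'\ \overset{p}{\longrightarrow}\ \Sigma_\xi\qquad\text{as }N,T\to\infty.$$ -/

import Mathlib

open MeasureTheory ProbabilityTheory Filter Topology
open scoped Kronecker Matrix.Norms.L2Operator

/-- Conditional independence, given the sigma-algebra `m`, of a family of random variables:
for every finite set of indices and all measurable sets `B i`, the conditional probability given
`m` of `{X i ∈ B i for all i ∈ S}` is almost surely the product of the conditional probabilities. -/
def CondIndepFamily {Ω ι E : Type*} [MeasurableSpace E] (m : MeasurableSpace Ω)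
    [mΩ : MeasurableSpace Ω] (P : Measure Ω) (X : ι → Ω → E) : Prop :=
  ∀ (S : Finset ι) (B : ι → Set E), (∀ i ∈ S, MeasurableSet (B i)) →
    P[(⋂ i ∈ S, X i ⁻¹' B i).indicator (fun _ => (1 : ℝ)) | m] =ᵐ[P]
      ∏ i ∈ S, P[(X i ⁻¹' B i).indicator (fun _ => (1 : ℝ)) | m]

/-- The outer square `x x'` of a vector. -/
def outer {k : ℕ} (x : EuclideanSpace ℝ (Fin k)) : Matrix (Fin k) (Fin k) ℝ :=
  Matrix.of fun a b => x a * x b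

/-- The entrywise expectation of a random matrix. -/
noncomputable def expMat {Ω m n : Type*} [MeasurableSpace Ω] (P : Measure Ω)
    (M : Ω → Matrix m n ℝ) : Matrix m n ℝ :=
  Matrix.of fun a b => ∫ x, M x a b ∂P

/-- The data of a panel with `N` units and `T` periods: a probability space, the common variables
`v s` and `w s t`, the non-random weights `γ i`, the errors `e i t` and the sigma-algebra `F` of
common shocks. -/
structure Panel (N T kv kw kγ : ℕ) where
  /-- the sample space -/
  Ω : Type*
  /-- its events -/
  [mΩ : MeasurableSpace Ω]
  /-- the probability measure -/
  P : Measure Ω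
  prob : IsProbabilityMeasure P
  /-- the linear common variables -/
  v : Fin T → Ω → EuclideanSpace ℝ (Fin kv)
  /-- the quadratic common variables -/
  w : Fin T → Fin T → Ω → EuclideanSpace ℝ (Fin kw)
  /-- the weights -/
  γ : Fin N → EuclideanSpace ℝ (Fin kγ)
  /-- the errors -/
  e : Fin N → Fin T → Ω → ℝ
  measurable_e : ∀ i t, Measurable (e i t)
  /-- the sigma-algebra of common shocks -/
  F : MeasurableSpace Ω
  F_le : F ≤ mΩ

attribute [instance] Panel.mΩ Panel.prob

/-- The latent data: factors `f t`, loadings `ld i`, remainders `η i t` and the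
standard deviations `σ i` of the remainders. -/
structure Latent {N T kv kw kγ : ℕ} (D : Panel N T kv kw kγ) (kf : ℕ) where
  /-- the factors -/
  f : Fin T → D.Ω → EuclideanSpace ℝ (Fin kf)
  measurable_f : ∀ t, Measurable (f t)
  /-- the loadings -/
  ld : Fin N → EuclideanSpace ℝ (Fin kf)
  /-- the remainders -/
  η : Fin N → Fin T → D.Ω → ℝ
  measurable_η : ∀ i t, Measurable (η i t)
  /-- the standard deviations of the remainders -/
  σ : Fin N → ℝ

namespace Panel

variable {N T kv kw kγ : ℕ}

/-- `ξ i`: the first block is `T^{-1/2} ∑ s, (γ i ⊗ v s) e i s`, the second block is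
`T⁻¹ ∑ s, ∑ t < s, w s t e i t e i s`. -/
noncomputable def ξ (D : Panel N T kv kw kγ) (i : Fin N) (x : D.Ω) :
    (Fin kγ × Fin kv) ⊕ Fin kw → ℝ :=
  Sum.elim
    (fun p => (1 / √(T : ℝ)) * ∑ s, D.γ i p.1 * D.v s x p.2 * D.e i s x)
    (fun j => (1 / (T : ℝ)) * ∑ s, ∑ t ∈ Finset.Iio s, D.w s t x j * (D.e i t x * D.e i s x))

/-- The covariance estimator `N⁻¹ ∑ i, ξ i (ξ i)'`. -/
noncomputable def covEst (D : Panel N T kv kw kγ) (x : D.Ω) :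
    Matrix ((Fin kγ × Fin kv) ⊕ Fin kw) ((Fin kγ × Fin kv) ⊕ Fin kw) ℝ :=
  (1 / (N : ℝ)) • ∑ i, Matrix.vecMulVec (D.ξ i x) (D.ξ i x)

/-- `T⁻¹ ∑ s, v s (v s)'` -/
noncomputable def avgV (D : Panel N T kv kw kγ) (x : D.Ω) : Matrix (Fin kv) (Fin kv) ℝ :=
  (1 / (T : ℝ)) • ∑ s, outer (D.v s x)

/-- `T⁻² ∑ s, ∑ t < s, w s t (w s t)'` -/
noncomputable def avgW (D : Panel N T kv kw kγ) (x : D.Ω) : Matrix (Fin kw) (Fin kw) ℝ :=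
  (1 / (T : ℝ) ^ 2) • ∑ s, ∑ t ∈ Finset.Iio s, outer (D.w s t x)

end Panel

section Assumptions

variable {kv kw kγ kf : ℕ}

/-- Assumptions on the common variables. Norms of vectors are Euclidean, norms of matrices are
operator norms, and all limits are joint limits in `(N, T)`. -/
structure CommonVariables (D : ∀ N T : ℕ, Panel N T kv kw kγ)
    (Ωv : Matrix (Fin kv) (Fin kv) ℝ) (Ωw : Matrix (Fin kw) (Fin kw) ℝ) : Prop where
  measurable_v : ∀ N T s, Measurable[(D N T).F] ((D N T).v s)
  measurable_w : ∀ N T s t, Measurable[(D N T).F] ((D N T).w s t)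
  mean_v : Tendsto (fun n : ℕ × ℕ => expMat (D n.1 n.2).P (D n.1 n.2).avgV)
    (atTop ×ˢ atTop) (𝓝 Ωv)
  mean_w : Tendsto (fun n : ℕ × ℕ => expMat (D n.1 n.2).P (D n.1 n.2).avgW)
    (atTop ×ˢ atTop) (𝓝 Ωw)
  fullRank_v : Ωv.rank = kv
  fullRank_w : Ωw.rank = kw
  moment_v : ∃ C : ℝ, ∀ N T s, Integrable (fun x => ‖(D N T).v s x‖ ^ 4) (D N T).P ∧
    ∫ x, ‖(D N T).v s x‖ ^ 4 ∂(D N T).P < C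
  moment_w : ∃ C : ℝ, ∀ N T s t, Integrable (fun x => ‖(D N T).w s t x‖ ^ 4) (D N T).P ∧
    ∫ x, ‖(D N T).w s t x‖ ^ 4 ∂(D N T).P < C
  lln_w : Tendsto (fun n : ℕ × ℕ =>
      ∫ x, ‖(D n.1 n.2).avgW x - expMat (D n.1 n.2).P (D n.1 n.2).avgW‖ ^ 2 ∂(D n.1 n.2).P)
    (atTop ×ˢ atTop) (𝓝 0)
  lln_v : Tendsto (fun n : ℕ × ℕ =>
      ∫ x, ‖(D n.1 n.2).avgV x - expMat (D n.1 n.2).P (D n.1 n.2).avgV‖ ^ 2 ∂(D n.1 n.2).P)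
    (atTop ×ˢ atTop) (𝓝 0)

/-- The weights are uniformly bounded. -/
def BoundedWeights (D : ∀ N T : ℕ, Panel N T kv kw kγ) : Prop :=
  ∃ C : ℝ, ∀ N T i, ‖(D N T).γ i‖ < C

/-- Assumptions on the errors. -/
structure ErrorConditions (D : ∀ N T : ℕ, Panel N T kv kw kγ) : Prop where
  serial : ∀ N T, CondIndepFamily (D N T).F (D N T).P
    (fun t x => (fun i => (D N T).e i t x : Fin N → ℝ))
  condMean : ∀ N T i t, (D N T).P[(D N T).e i t | (D N T).F] =ᵐ[(D N T).P] 0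
  moment : ∃ C : ℝ, ∀ N T i t, Integrable (fun x => (D N T).e i t x ^ 4) (D N T).P ∧
    ∫ x, (D N T).e i t x ^ 4 ∂(D N T).P < C

/-- Assumptions on the weak latent factor structure of the errors. -/
structure WeakFactorStructure (D : ∀ N T : ℕ, Panel N T kv kw kγ)
    (L : ∀ N T : ℕ, Latent (D N T) kf)
    (Γπγ : Matrix (Fin kf) (Fin kγ) ℝ) (Γω : Matrix (Fin kγ) (Fin kγ) ℝ) (ω : ℝ)
    (Sfv : Matrix (Fin kf × Fin kv) (Fin kf × Fin kv) ℝ) : Prop where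
  decomposition : ∀ N T i t, ∀ᵐ x ∂(D N T).P,
    (D N T).e i t x = (∑ a, (L N T).ld i a * (L N T).f t x a) + (L N T).η i t x
  -- the factors
  serial_f : ∀ N T, CondIndepFamily (D N T).F (D N T).P (L N T).f
  condMean_f : ∀ N T t a,
    (D N T).P[fun x => (L N T).f t x a | (D N T).F] =ᵐ[(D N T).P] 0
  variance_f : ∀ N T t, expMat (D N T).P (fun x => outer ((L N T).f t x)) = 1
  moment_vf : ∃ C : ℝ, ∀ N T s t,
    Integrable (fun x => (‖(D N T).v s x‖ ^ 4 + 1) * ‖(L N T).f t x‖ ^ 4) (D N T).P ∧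
    ∫ x, (‖(D N T).v s x‖ ^ 4 + 1) * ‖(L N T).f t x‖ ^ 4 ∂(D N T).P < C
  moment_wf : ∃ C : ℝ, ∀ N T s r t,
    Integrable (fun x => ‖(D N T).w s r x‖ ^ 4 * ‖(L N T).f t x‖ ^ 8) (D N T).P ∧
    ∫ x, ‖(D N T).w s r x‖ ^ 4 * ‖(L N T).f t x‖ ^ 8 ∂(D N T).P < C
  -- the loadings: every eigenvalue of `∑ i, π i (π i)'` is below `C`
  weak : ∃ C : ℝ, ∀ N T, ∀ μ ∈ spectrum ℝ (∑ i, outer ((L N T).ld i)), μ < C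
  cross : Tendsto (fun n : ℕ × ℕ => (1 / √(n.1 : ℝ)) •
      ∑ i, (Matrix.of fun a b => (L n.1 n.2).ld i a * (D n.1 n.2).γ i b))
    (atTop ×ˢ atTop) (𝓝 Γπγ)
  -- the remainders
  indep_η : ∀ N T, iIndepFun (fun p : Fin N × Fin T => (L N T).η p.1 p.2) (D N T).P
  indep_η_common : ∀ N T,
    Indep (⨆ p : Fin N × Fin T, MeasurableSpace.comap ((L N T).η p.1 p.2) inferInstance)
      ((D N T).F ⊔ ⨆ t, MeasurableSpace.comap ((L N T).f t) inferInstance) (D N T).P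
  mean_η : ∀ N T i t, ∫ x, (L N T).η i t x ∂(D N T).P = 0
  variance_η : ∀ N T i t, variance ((L N T).η i t) (D N T).P = (L N T).σ i ^ 2
  bounded_variance : ∃ C : ℝ, ∀ N T i, (L N T).σ i ^ 2 < C
  lim_fourth : Tendsto (fun n : ℕ × ℕ => (1 / (n.1 : ℝ)) * ∑ i, (L n.1 n.2).σ i ^ 4)
    (atTop ×ˢ atTop) (𝓝 (ω ^ 4))
  lim_weighted : Tendsto (fun n : ℕ × ℕ => (1 / (n.1 : ℝ)) •
      ∑ i, (L n.1 n.2).σ i ^ 2 • outer ((D n.1 n.2).γ i))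
    (atTop ×ˢ atTop) (𝓝 Γω)
  fullRank_Γω : Γω.rank = kγ
  moment_η : ∃ C : ℝ, ∀ N T i t, Integrable (fun x => (L N T).η i t x ^ 4) (D N T).P ∧
    ∫ x, (L N T).η i t x ^ 4 ∂(D N T).P < C
  -- needed only if the weights are not asymptotically orthogonal to the loadings
  lln_fv : Γπγ ≠ 0 → Tendsto (fun n : ℕ × ℕ =>
      ∫ x, ‖(1 / (n.2 : ℝ)) • (∑ s, outer ((L n.1 n.2).f s x) ⊗ₖ outer ((D n.1 n.2).v s x))
        - Sfv‖ ^ 2 ∂(D n.1 n.2).P)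
    (atTop ×ˢ atTop) (𝓝 0)

end Assumptions

/-- `Σ_V = (Γπγ' ⊗ I) Sfv (Γπγ ⊗ I) + Γω ⊗ Ωv` -/
def sigmaV {kv kγ kf : ℕ} (Γπγ : Matrix (Fin kf) (Fin kγ) ℝ)
    (Sfv : Matrix (Fin kf × Fin kv) (Fin kf × Fin kv) ℝ)
    (Γω : Matrix (Fin kγ) (Fin kγ) ℝ) (Ωv : Matrix (Fin kv) (Fin kv) ℝ) :
    Matrix (Fin kγ × Fin kv) (Fin kγ × Fin kv) ℝ :=
  (Γπγ.transpose ⊗ₖ (1 : Matrix (Fin kv) (Fin kv) ℝ)) * Sfv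
    * (Γπγ ⊗ₖ (1 : Matrix (Fin kv) (Fin kv) ℝ)) + Γω ⊗ₖ Ωv

/-- The block-diagonal matrix with blocks `Σ_V` and `Σ_W = ω ^ 4 Ωw`. -/
def sigmaXi {kv kw kγ kf : ℕ} (Γπγ : Matrix (Fin kf) (Fin kγ) ℝ)
    (Sfv : Matrix (Fin kf × Fin kv) (Fin kf × Fin kv) ℝ)
    (Γω : Matrix (Fin kγ) (Fin kγ) ℝ) (Ωv : Matrix (Fin kv) (Fin kv) ℝ)
    (ω : ℝ) (Ωw : Matrix (Fin kw) (Fin kw) ℝ) :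
    Matrix ((Fin kγ × Fin kv) ⊕ Fin kw) ((Fin kγ × Fin kv) ⊕ Fin kw) ℝ :=
  Matrix.fromBlocks (sigmaV Γπγ Sfv Γω Ωv) 0 0 (ω ^ 4 • Ωw)

/-- Convergence in probability, as `N` and `T` tend jointly to infinity, of random matrices
defined on the probability spaces of the panels, to a constant matrix. -/
def TendstoInProbability {kv kw kγ : ℕ} {m : Type*} [Fintype m] [DecidableEq m]
    (D : ∀ N T : ℕ, Panel N T kv kw kγ)
    (X : ∀ N T : ℕ, (D N T).Ω → Matrix m m ℝ) (A : Matrix m m ℝ) : Prop :=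
  ∀ ε : ℝ, 0 < ε → Tendsto (fun n : ℕ × ℕ =>
      (D n.1 n.2).P {x | ε ≤ ‖X n.1 n.2 x - A‖})
    (atTop ×ˢ atTop) (𝓝 0)

/-!
Almost surely `e i t = π i' f t + η i t`, so `ξ i = X i + r i`, where `X i` is
the value of `ξ i` when the errors are the remainders `η i t` alone (`Panel.score D i (L.η i)`).

*The factors drop out.* Given the common shocks and everything that happens at other times, `f t`
and `η i t` are centred (`condExp_factorPart`, `condExp_η`). Hence the summands of `r i` are
orthogonal, and `E ‖r i‖² = O(‖π i‖²)` (`score_factor_moment`). The eigenvalue bound makes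
`∑ i, ‖π i‖²`, the trace of `∑ i, π i (π i)'`, bounded, so the average of `E ‖r i‖²` over the units
is `O(1 / N)`.

*The remainder parts obey a law of large numbers.* Given the common shocks, the `X i` are
independent across `i`, with conditional second moment `L.centre i`, block diagonal because
square-free monomials in the `η i t` of different degree are orthogonal (`integral_mul_sub_centre`). The products of the
coordinates of `X i`, minus `L.centre i`, are therefore orthogonal across `i`. Their second moments
are bounded since `X i` has bounded fourth moments. For the linear block this is a fourth moment
bound for a martingale, and for the quadratic block it is the same bound applied twice
(`integral_pow_four_sum_le`, `score_remainder_moment`).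

Together, the estimator is within `O(N^{-1/2})` in mean of the average of `L.centre i`
(`integral_abs_covEst_sub_le`). That average is a non-random weight times `avgV` or `avgW`, and
converges in mean by the assumed laws of large numbers (`tendsto_integral_abs_centre_sub`). Markov's
inequality concludes. Since `f` contributes nothing to the limit, the estimator misses the first
summand of `Σ_V`; the orthogonality `Γπγ = 0` removes that summand.
-/

/-! ### Variables centred given a σ-algebra -/

section CentredGiven

variable {Ω : Type*} {K K' m₁ m₂ m₃ F : MeasurableSpace Ω} [mΩ : MeasurableSpace Ω]
  {P : Measure Ω}

/-- Integrals that vanish over the intersections of the members of two π-systems vanish over the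
σ-algebra that the two generate together. -/
lemma setIntegral_eq_zero_of_inter {p q : Set (Set Ω)} (hp : IsPiSystem p) (hq : IsPiSystem q)
    (hpu : Set.univ ∈ p) (hqu : Set.univ ∈ q)
    (hpm : MeasurableSpace.generateFrom p ≤ mΩ) (hqm : MeasurableSpace.generateFrom q ≤ mΩ)
    {X : Ω → ℝ} (hX : Integrable X P)
    (h : ∀ a ∈ p, ∀ b ∈ q, ∫ x in a ∩ b, X x ∂P = 0) (s : Set Ω)
    (hs : MeasurableSet[MeasurableSpace.generateFrom p ⊔ MeasurableSpace.generateFrom q] s) :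
    ∫ x in s, X x ∂P = 0 := by
  have hle : MeasurableSpace.generateFrom p ⊔ MeasurableSpace.generateFrom q ≤ mΩ :=
    sup_le hpm hqm
  have hgen : MeasurableSpace.generateFrom p ⊔ MeasurableSpace.generateFrom q
      = MeasurableSpace.generateFrom (Set.image2 (· ∩ ·) p q) := by
    apply le_antisymm
    · refine sup_le (MeasurableSpace.generateFrom_mono ?_) (MeasurableSpace.generateFrom_mono ?_)
      · intro a ha; exact ⟨a, ha, Set.univ, hqu, by simp⟩
      · intro b hb; exact ⟨Set.univ, hpu, b, hb, by simp⟩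
    · refine MeasurableSpace.generateFrom_le ?_
      rintro _ ⟨a, ha, b, hb, rfl⟩
      exact MeasurableSet.inter (le_sup_left (a := MeasurableSpace.generateFrom p) _
          (MeasurableSpace.measurableSet_generateFrom ha))
        (le_sup_right (a := MeasurableSpace.generateFrom p) _
          (MeasurableSpace.measurableSet_generateFrom hb))
  have hpi : IsPiSystem (Set.image2 (· ∩ ·) p q) := by
    rintro _ ⟨a, ha, b, hb, rfl⟩ _ ⟨a', ha', b', hb', rfl⟩ hne
    refine ⟨a ∩ a', hp _ ha _ ha' (hne.mono ?_), b ∩ b', hq _ hb _ hb' (hne.mono ?_), ?_⟩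
    · intro x hx; exact ⟨hx.1.1, hx.2.1⟩
    · intro x hx; exact ⟨hx.1.2, hx.2.2⟩
    · exact Set.inter_inter_inter_comm a a' b b'
  induction s, hs using MeasurableSpace.induction_on_inter hgen hpi with
  | empty => simp
  | basic t ht => obtain ⟨a, ha, b, hb, rfl⟩ := ht; exact h a ha b hb
  | compl t ht ih =>
    have h1 := integral_add_compl (hle _ ht) hX
    have h2 := h _ hpu _ hqu
    simp only [Set.inter_self, setIntegral_univ] at h2
    linarith
  | iUnion f hd hm ih =>
    rw [integral_iUnion (fun i => hle _ (hm i)) hd hX.integrableOn]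
    simp [ih]

variable [IsProbabilityMeasure P]

lemma condExp_eq_zero_of_setIntegral (hK : K ≤ mΩ) {X : Ω → ℝ}
    (hX : Integrable X P) (h : ∀ s, MeasurableSet[K] s → ∫ x in s, X x ∂P = 0) :
    P[X | K] =ᵐ[P] 0 := by
  refine (ae_eq_condExp_of_forall_setIntegral_eq (g := fun _ => (0 : ℝ)) hK hX ?_ ?_ ?_).symm
  · intro s _ _; exact integrableOn_zero
  · intro s hs _; simp [h s hs]
  · exact aestronglyMeasurable_const

lemma setIntegral_eq_zero_of_condExp (hK : K ≤ mΩ) {X : Ω → ℝ}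
    (hX : Integrable X P) (h : P[X | K] =ᵐ[P] 0) {s : Set Ω} (hs : MeasurableSet[K] s) :
    ∫ x in s, X x ∂P = 0 := by
  rw [← setIntegral_condExp hK hX hs]
  exact setIntegral_eq_zero_of_ae_eq_zero (h.mono fun x hx _ => hx)

lemma condExp_eq_zero_mono (hK : K ≤ mΩ) (hKK : K' ≤ K) {X : Ω → ℝ}
    (h : P[X | K] =ᵐ[P] 0) : P[X | K'] =ᵐ[P] 0 := by
  have h1 := condExp_condExp_of_le (μ := P) (f := X) hKK hK
  refine h1.symm.trans ((condExp_congr_ae h).trans ?_)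
  simp

lemma integral_mul_eq_zero_of_condExp (hK : K ≤ mΩ) {X Z : Ω → ℝ}
    (hX : Integrable X P) (h : P[X | K] =ᵐ[P] 0) (hZ : StronglyMeasurable[K] Z)
    (hZX : Integrable (fun x => Z x * X x) P) : ∫ x, Z x * X x ∂P = 0 := by
  have h1 := condExp_mul_of_stronglyMeasurable_left (m := K) hZ hZX hX
  calc ∫ x, Z x * X x ∂P = ∫ x, (P[Z * X | K]) x ∂P := (integral_condExp hK).symm
    _ = ∫ _, (0 : ℝ) ∂P := by
        refine integral_congr_ae ?_
        filter_upwards [h1, h] with x h1 h2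
        simp [h1, h2]
    _ = 0 := by simp

/-- A variable centred given `m₁` is centred given `m₁ ⊔ m₂`, if `m₂` is independent of both the
variable and `m₁`. -/
lemma condExp_sup_eq_zero_of_indep (h₁ : m₁ ≤ m₃) (h₂ : m₂ ≤ mΩ)
    (h₃ : m₃ ≤ mΩ) (hind : Indep m₂ m₃ P) {X : Ω → ℝ} (hXm : StronglyMeasurable[m₃] X)
    (hX : Integrable X P) (h : P[X | m₁] =ᵐ[P] 0) : P[X | m₁ ⊔ m₂] =ᵐ[P] 0 := by
  have h₁' := h₁.trans h₃
  refine condExp_eq_zero_of_setIntegral (sup_le h₁' h₂) hX ?_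
  have key := setIntegral_eq_zero_of_inter (P := P) (p := {s | MeasurableSet[m₁] s})
    (q := {s | MeasurableSet[m₂] s}) (X := X)
    (@MeasurableSpace.isPiSystem_measurableSet _ m₁)
    (@MeasurableSpace.isPiSystem_measurableSet _ m₂)
    MeasurableSet.univ MeasurableSet.univ
    (by rw [@MeasurableSpace.generateFrom_measurableSet _ m₁]; exact h₁')
    (by rw [@MeasurableSpace.generateFrom_measurableSet _ m₂]; exact h₂) hX ?_
  · intro s hs
    refine key s ?_
    rw [@MeasurableSpace.generateFrom_measurableSet _ m₁,
      @MeasurableSpace.generateFrom_measurableSet _ m₂]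
    exact hs
  · intro a ha b hb
    have e1 : ∫ x in a ∩ b, X x ∂P
        = ∫ x, (b.indicator (fun _ => (1 : ℝ)) * a.indicator X) x ∂P := by
      rw [← integral_indicator ((h₁' _ ha).inter (h₂ _ hb))]
      refine integral_congr_ae (Eventually.of_forall fun x => ?_)
      by_cases hxa : x ∈ a <;> by_cases hxb : x ∈ b <;> simp [hxa, hxb]
    have mb : StronglyMeasurable[m₂] (b.indicator (fun _ => (1 : ℝ))) :=
      stronglyMeasurable_const.indicator hb
    have ma : StronglyMeasurable[m₃] (a.indicator X) := hXm.indicator (h₁ _ ha)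
    have hif : IndepFun (b.indicator (fun _ => (1 : ℝ))) (a.indicator X) P :=
      (indep_of_indep_of_le_left (indep_of_indep_of_le_right hind ma.measurable.comap_le)
        mb.measurable.comap_le)
    rw [e1, hif.integral_mul_eq_mul_integral (mb.mono h₂).aestronglyMeasurable
      (ma.mono h₃).aestronglyMeasurable, integral_indicator (h₁' _ ha),
      setIntegral_eq_zero_of_condExp h₁' hX h ha, mul_zero]

/-- If `m₂` is independent of `m₃` and `m₁` is independent of `m₂ ⊔ m₃`, then `m₂` is independent
of `m₁ ⊔ m₃`. -/
lemma indep_sup_right_of_indep (h₁ : m₁ ≤ mΩ) (h₂ : m₂ ≤ mΩ)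
    (h₃ : m₃ ≤ mΩ) (h23 : Indep m₂ m₃ P) (h1 : Indep (m₂ ⊔ m₃) m₁ P) : Indep m₂ (m₁ ⊔ m₃) P := by
  rw [Indep_iff]
  intro s t hs ht
  -- independence from `s` says that the indicator of `s` is centred after subtracting `P s`
  have hs' := h₂ _ hs
  set X : Ω → ℝ := fun x => s.indicator (fun _ => (1 : ℝ)) x - P.real s with hXdef
  have hX : Integrable X P := ((integrable_const _).indicator hs').sub (integrable_const _)
  have hXm : StronglyMeasurable[m₂] X :=
    (stronglyMeasurable_const.indicator hs).sub stronglyMeasurable_const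
  have hX3 : P[X | m₃] =ᵐ[P] 0 := by
    refine (condExp_indep_eq h₂ h₃ hXm h23).trans (Eventually.of_forall fun x => ?_)
    simp [hXdef, integral_sub ((integrable_const (1 : ℝ)).indicator hs') (integrable_const _),
      integral_indicator hs', measureReal_def]
  have hsup : P[X | m₃ ⊔ m₁] =ᵐ[P] 0 :=
    condExp_sup_eq_zero_of_indep (m₃ := m₂ ⊔ m₃) le_sup_right h₁ (sup_le h₂ h₃) h1.symm
      (hXm.mono le_sup_left) hX hX3
  rw [sup_comm] at ht
  have ht' : MeasurableSet t := (sup_le h₃ h₁) _ ht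
  have h0 := setIntegral_eq_zero_of_condExp (sup_le h₃ h₁) hX hsup ht
  rw [hXdef, integral_sub ((integrable_const (1 : ℝ)).indicator hs').integrableOn
    (integrable_const _).integrableOn, setIntegral_indicator hs'] at h0
  simp only [setIntegral_const, smul_eq_mul, mul_one] at h0
  rw [← ENNReal.toReal_eq_toReal_iff' (measure_ne_top _ _)
    (ENNReal.mul_ne_top (measure_ne_top _ _) (measure_ne_top _ _)), ENNReal.toReal_mul]
  simp only [measureReal_def] at h0
  rw [Set.inter_comm]
  linarith

/-- In a conditionally independent family, a function of one member that is centred given `F` stays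
centred when the other members are also given. -/
lemma CondIndepFamily.condExp_eq_zero {ι E : Type*} [MeasurableSpace E]
    (hF : F ≤ mΩ) {X : ι → Ω → E} (hXm : ∀ i, Measurable (X i))
    (hX : CondIndepFamily F P X) (t : ι) {Y : Ω → ℝ}
    (hYm : StronglyMeasurable[MeasurableSpace.comap (X t) inferInstance] Y) (hY : Integrable Y P)
    (hY0 : P[Y | F] =ᵐ[P] 0) :
    P[Y | F ⊔ ⨆ r ∈ ({t}ᶜ : Set ι), MeasurableSpace.comap (X r) inferInstance] =ᵐ[P] 0 := by
  classical
  have hX' : ∀ i, MeasurableSpace.comap (X i) inferInstance ≤ mΩ := fun i => (hXm i).comap_le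
  have hsup : ⨆ r ∈ ({t}ᶜ : Set ι), MeasurableSpace.comap (X r) inferInstance ≤ mΩ :=
    iSup₂_le fun i _ => hX' i
  refine condExp_eq_zero_of_setIntegral (sup_le hF hsup) hY ?_
  have hgen := generateFrom_piiUnionInter_measurableSet
    (fun r => MeasurableSpace.comap (X r) inferInstance) ({t}ᶜ : Set ι)
  have key := setIntegral_eq_zero_of_inter (P := P) (p := {s | MeasurableSet[F] s})
    (q := piiUnionInter (fun r => {s | MeasurableSet[MeasurableSpace.comap (X r) inferInstance] s})
      ({t}ᶜ : Set ι)) (X := Y)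
    (@MeasurableSpace.isPiSystem_measurableSet _ F)
    (isPiSystem_piiUnionInter _ (fun r => @MeasurableSpace.isPiSystem_measurableSet _
      (MeasurableSpace.comap (X r) inferInstance)) _)
    MeasurableSet.univ ⟨∅, by simp, fun _ => Set.univ, by simp, by simp⟩
    (by rw [@MeasurableSpace.generateFrom_measurableSet _ F]; exact hF)
    (by rw [hgen]; exact hsup) hY ?_
  · intro s hs
    refine key s ?_
    rw [@MeasurableSpace.generateFrom_measurableSet _ F, hgen]
    exact hs
  · rintro a ha _ ⟨S, hS, g, hg, rfl⟩
    have hB : ∀ r ∈ S, ∃ B, MeasurableSet B ∧ X r ⁻¹' B = g r := fun r hr => hg r hr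
    choose! B hBm hBg using hB
    have htS : t ∉ S := fun h => hS h rfl
    have hC : (⋂ r ∈ S, g r) = ⋂ r ∈ S, X r ⁻¹' B r :=
      Set.iInter₂_congr fun r hr => (hBg r hr).symm
    set C := ⋂ r ∈ S, X r ⁻¹' B r with hCdef
    have hCm : MeasurableSet C := Finset.measurableSet_biInter _ fun r hr => hXm r (hBm r hr)
    rw [hC]
    set q : Ω → ℝ := P[C.indicator (fun _ => (1 : ℝ)) | F] with hq
    have hqm : StronglyMeasurable[F] q := stronglyMeasurable_condExp
    have hqb : ∀ᵐ x ∂P, |q x| ≤ 1 := by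
      have := ae_bdd_abs_condExp_of_ae_bdd_abs (m := F) (μ := P) (R := (1 : ℝ))
        (f := C.indicator (fun _ => (1 : ℝ))) (Eventually.of_forall fun x => by
          by_cases hx : x ∈ C <;> simp [hx])
      simpa using this
    have hqi : Integrable q P := integrable_condExp
    have hai := hF _ ha
    -- `Z` is the difference of the indicator of `a ∩ C` and its conditional expectation
    set Z : Ω → ℝ := a.indicator (fun x => C.indicator (fun _ => (1 : ℝ)) x - q x) with hZ
    have hCi : Integrable (C.indicator (fun _ => (1 : ℝ))) P := (integrable_const _).indicator hCm
    have hZi : Integrable Z P := (hCi.sub hqi).indicator hai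
    have hZb : ∀ᵐ x ∂P, ‖Z x‖ ≤ 2 := by
      filter_upwards [hqb] with x hx
      rw [abs_le] at hx
      by_cases hxa : x ∈ a <;> by_cases hxC : x ∈ C <;>
        simp [hZ, hxa, hxC, abs_le] <;> constructor <;> linarith
    have hZ0 : P[Z | MeasurableSpace.comap (X t) inferInstance] =ᵐ[P] 0 := by
      refine condExp_eq_zero_of_setIntegral (hX' t) hZi ?_
      rintro _ ⟨B', hB', rfl⟩
      have hDm : MeasurableSet (X t ⁻¹' B') := hXm t hB'
      set D := X t ⁻¹' B' with hD
      -- conditional independence of `C` and `D`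
      have hprod : P[(C ∩ D).indicator (fun _ => (1 : ℝ)) | F] =ᵐ[P]
          q * P[D.indicator (fun _ => (1 : ℝ)) | F] := by
        have h1 := hX (insert t S) (Function.update B t B') (by
          intro i hi
          by_cases hit : i = t
          · subst hit; simpa using hB'
          · rw [Function.update_of_ne hit]
            exact hBm i ((Finset.mem_insert.1 hi).resolve_left hit))
        have h2 := hX S B hBm
        have hne : ∀ i ∈ S, i ≠ t := fun i hi h => htS (h ▸ hi)
        have hset : (⋂ i ∈ insert t S, X i ⁻¹' Function.update B t B' i) = C ∩ D := by
          rw [Finset.set_biInter_insert, Function.update_self, Set.inter_comm]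
          congr 1
          exact Set.iInter₂_congr fun i hi => by rw [Function.update_of_ne (hne i hi)]
        rw [hset, Finset.prod_insert htS, Function.update_self] at h1
        have hpr : ∏ i ∈ S, P[(X i ⁻¹' Function.update B t B' i).indicator
              (fun _ => (1 : ℝ)) | F]
            = ∏ i ∈ S, P[(X i ⁻¹' B i).indicator (fun _ => (1 : ℝ)) | F] :=
          Finset.prod_congr rfl fun i hi => by rw [Function.update_of_ne (hne i hi)]
        rw [hpr] at h1
        filter_upwards [h1, h2] with x h1 h2
        rw [h1, Pi.mul_apply, Pi.mul_apply, ← h2, mul_comm]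
      have hDi : Integrable (D.indicator (fun _ => (1 : ℝ))) P :=
        (integrable_const _).indicator hDm
      have hCDi : Integrable ((C ∩ D).indicator (fun _ => (1 : ℝ))) P :=
        (integrable_const _).indicator (hCm.inter hDm)
      have hqD : Integrable (q * D.indicator (fun _ => (1 : ℝ))) P :=
        (hDi.bdd_mul (c := 1) hqi.aestronglyMeasurable (by simpa using hqb))
      have hpull := condExp_mul_of_stronglyMeasurable_left (m := F) hqm hqD hDi
      have e1 : ∫ x in D, Z x ∂P = ∫ x in a, ((C ∩ D).indicator (fun _ => (1 : ℝ)) x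
          - (q * D.indicator (fun _ => (1 : ℝ))) x) ∂P := by
        rw [← integral_indicator hDm, ← integral_indicator hai]
        refine integral_congr_ae (Eventually.of_forall fun x => ?_)
        by_cases hxa : x ∈ a <;> by_cases hxC : x ∈ C <;> by_cases hxD : x ∈ D <;>
          simp [hZ, hxa, hxC, hxD]
      rw [e1, integral_sub hCDi.integrableOn hqD.integrableOn,
        ← setIntegral_condExp hF hCDi ha, ← setIntegral_condExp hF hqD ha, sub_eq_zero]
      refine setIntegral_congr_ae hai ?_
      filter_upwards [hprod, hpull] with x h1 h2 _
      rw [h1, h2]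
    have hYZ : Integrable (fun x => Y x * Z x) P := by
      simpa [mul_comm] using (hY.bdd_mul (c := 2) hZi.aestronglyMeasurable hZb)
    have h0 := integral_mul_eq_zero_of_condExp (hX' t) hZi hZ0 hYm hYZ
    have haq : StronglyMeasurable[F] (a.indicator q) := hqm.indicator ha
    have hqY : Integrable (fun x => a.indicator q x * Y x) P := by
      refine hY.bdd_mul (c := 1) (haq.mono hF).aestronglyMeasurable ?_
      filter_upwards [hqb] with x hx
      by_cases hxa : x ∈ a <;> simp [hxa, hx]
    have h1 := integral_mul_eq_zero_of_condExp hF hY hY0 haq hqY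
    rw [← integral_indicator (hai.inter hCm)]
    have e2 : (fun x => (a ∩ C).indicator Y x)
        = fun x => Y x * Z x + a.indicator q x * Y x := by
      funext x
      by_cases hxa : x ∈ a <;> by_cases hxC : x ∈ C <;> simp [hZ, hxa, hxC] <;> ring
    rw [e2, integral_add hYZ hqY, h0, h1, add_zero]

end CentredGiven

/-! ### Orthogonal sums and fourth moments -/

section Orthogonality

variable {Ω : Type*} {F : MeasurableSpace Ω} [mΩ : MeasurableSpace Ω] {P : Measure Ω}

lemma integral_sq_sum_of_orthogonal {ι : Type*} (A : Finset ι) {X : ι → Ω → ℝ}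
    (h2 : ∀ p ∈ A, MemLp (X p) 2 P)
    (h0 : ∀ p ∈ A, ∀ q ∈ A, p ≠ q → ∫ x, X p x * X q x ∂P = 0) :
    ∫ x, (∑ p ∈ A, X p x) ^ 2 ∂P = ∑ p ∈ A, ∫ x, X p x ^ 2 ∂P := by
  have hint : ∀ p ∈ A, ∀ q ∈ A, Integrable (fun x => X p x * X q x) P :=
    fun p hp q hq => (h2 p hp).integrable_mul (h2 q hq)
  simp_rw [sq, Finset.sum_mul_sum]
  rw [integral_finsetSum _ fun p hp => integrable_finsetSum _ fun q hq => hint p hp q hq]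
  refine Finset.sum_congr rfl fun p hp => ?_
  rw [integral_finsetSum _ fun q hq => hint p hp q hq]
  exact Finset.sum_eq_single_of_mem p hp fun q hq hqp => h0 p hp q hq hqp.symm

variable [IsProbabilityMeasure P]

/-- Second moment of a linear form in variables `X s`, each centred given the others and `F`. -/
lemma integral_sq_linear_form {ι : Type*} [Fintype ι] {K : ι → MeasurableSpace Ω}
    (hK : ∀ s, K s ≤ mΩ) (hFK : ∀ s, F ≤ K s) {c X : ι → Ω → ℝ}
    (hc : ∀ s, StronglyMeasurable[F] (c s)) (hX : ∀ s, Integrable (X s) P)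
    (hXK : ∀ r s, r ≠ s → StronglyMeasurable[K s] (X r)) (h0 : ∀ s, P[X s | K s] =ᵐ[P] 0)
    (h2 : ∀ s, MemLp (fun x => c s x * X s x) 2 P) :
    ∫ x, (∑ s, c s x * X s x) ^ 2 ∂P = ∑ s, ∫ x, (c s x * X s x) ^ 2 ∂P := by
  refine integral_sq_sum_of_orthogonal Finset.univ (fun s _ => h2 s) fun p _ q _ hpq => ?_
  have hZ : StronglyMeasurable[K q] (fun x => c p x * X p x * c q x) :=
    (((hc p).mono (hFK q)).mul (hXK p q hpq)).mul ((hc q).mono (hFK q))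
  have e : (fun x => c p x * X p x * (c q x * X q x))
      = fun x => (c p x * X p x * c q x) * X q x := by funext x; ring
  have hi : Integrable (fun x => c p x * X p x * (c q x * X q x)) P :=
    (h2 p).integrable_mul (h2 q)
  rw [e] at hi ⊢
  exact integral_mul_eq_zero_of_condExp (hK q) (hX q) (h0 q) hZ hi

/-- Second moment of a triangular bilinear form in variables `X t`, `Y s`, `t < s`, which are
centred given `F` and all the variables of other times. -/
lemma integral_sq_bilinear_form {ι : Type*} [Fintype ι] [LinearOrder ι] [LocallyFiniteOrderBot ι]
    {K : ι → MeasurableSpace Ω} (hK : ∀ s, K s ≤ mΩ) (hFK : ∀ s, F ≤ K s)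
    {c : ι → ι → Ω → ℝ} {X Y : ι → Ω → ℝ} (hc : ∀ s t, StronglyMeasurable[F] (c s t))
    (hX : ∀ s, Integrable (X s) P) (hY : ∀ s, Integrable (Y s) P)
    (hXK : ∀ r s, r ≠ s → StronglyMeasurable[K s] (X r))
    (hYK : ∀ r s, r ≠ s → StronglyMeasurable[K s] (Y r))
    (hX0 : ∀ s, P[X s | K s] =ᵐ[P] 0) (hY0 : ∀ s, P[Y s | K s] =ᵐ[P] 0)
    (h2 : ∀ s t, t < s → MemLp (fun x => c s t x * (X t x * Y s x)) 2 P) :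
    ∫ x, (∑ s, ∑ t ∈ Finset.Iio s, c s t x * (X t x * Y s x)) ^ 2 ∂P
      = ∑ s, ∑ t ∈ Finset.Iio s, ∫ x, (c s t x * (X t x * Y s x)) ^ 2 ∂P := by
  simp_rw [Finset.sum_sigma']
  have hlt : ∀ p : (_ : ι) × ι, p ∈ Finset.univ.sigma (fun s : ι => Finset.Iio s) →
      p.2 < p.1 := fun p hp => by simpa using hp
  have hYlast : ∀ p q : (_ : ι) × ι, p.2 < p.1 → q.2 < q.1 → q.1 ≠ p.1 → q.1 ≠ p.2 →
      ∫ x, c p.1 p.2 x * (X p.2 x * Y p.1 x) * (c q.1 q.2 x * (X q.2 x * Y q.1 x)) ∂P = 0 := by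
    rintro ⟨s, t⟩ ⟨s', t'⟩ hp hq h1 h2'
    simp only at hp hq h1 h2' ⊢
    have hZ : StronglyMeasurable[K s']
        (fun x => c s t x * (X t x * Y s x) * (c s' t' x * X t' x)) :=
      (((hc s t).mono (hFK _)).mul ((hXK _ _ h2'.symm).mul (hYK _ _ h1.symm))).mul
        (((hc _ _).mono (hFK _)).mul (hXK _ _ hq.ne))
    have e : (fun x => c s t x * (X t x * Y s x) * (c s' t' x * (X t' x * Y s' x)))
      = fun x => (c s t x * (X t x * Y s x) * (c s' t' x * X t' x)) * Y s' x := by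
        funext x; ring
    have hi : Integrable (fun x => c s t x * (X t x * Y s x) * (c s' t' x * (X t' x * Y s' x))) P :=
      (h2 s t hp).integrable_mul (h2 s' t' hq)
    rw [e] at hi ⊢
    exact integral_mul_eq_zero_of_condExp (hK s') (hY s') (hY0 s') hZ hi
  refine integral_sq_sum_of_orthogonal (X := fun (p : (_ : ι) × ι) x =>
    c p.1 p.2 x * (X p.2 x * Y p.1 x)) _ (fun p hp => h2 _ _ (hlt p hp)) fun p hp q hq hpq => ?_
  have hp' := hlt p hp
  have hq' := hlt q hq
  by_cases h1 : q.1 ≠ p.1 ∧ q.1 ≠ p.2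
  · exact hYlast p q hp' hq' h1.1 h1.2
  by_cases h3 : p.1 ≠ q.1 ∧ p.1 ≠ q.2
  · have := hYlast q p hq' hp' h3.1 h3.2
    simpa [mul_comm] using this
  -- the later times coincide, so the earlier ones differ
  obtain ⟨s, t⟩ := p
  obtain ⟨s', t'⟩ := q
  simp only at hp' hq' h1 h3 ⊢
  have hss : s' = s := by
    by_contra hne
    have e1 : s' = t := by by_contra h; exact h1 ⟨hne, h⟩
    have e2 : s = t' := by by_contra h; exact h3 ⟨fun h => hne h.symm, h⟩
    subst e1; subst e2
    exact lt_asymm hp' hq'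
  subst hss
  have htt : t ≠ t' := fun h => hpq (by rw [h])
  have hZ : StronglyMeasurable[K t']
      (fun x => c s' t x * (X t x * Y s' x) * (c s' t' x * Y s' x)) :=
    (((hc _ _).mono (hFK _)).mul ((hXK _ _ htt).mul (hYK _ _ hq'.ne'))).mul
      (((hc _ _).mono (hFK _)).mul (hYK _ _ hq'.ne'))
  have e : (fun x => c s' t x * (X t x * Y s' x) * (c s' t' x * (X t' x * Y s' x)))
    = fun x => (c s' t x * (X t x * Y s' x) * (c s' t' x * Y s' x)) * X t' x := by
      funext x; ring
  have hi : Integrable (fun x => c s' t x * (X t x * Y s' x) *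
      (c s' t' x * (X t' x * Y s' x))) P :=
    (h2 s' t hp').integrable_mul (h2 s' t' hq')
  rw [e] at hi ⊢
  exact integral_mul_eq_zero_of_condExp (hK t') (hX t') (hX0 t') hZ hi

end Orthogonality

section FourthMoment

variable {Ω : Type*} [mΩ : MeasurableSpace Ω] {P : Measure Ω}

lemma memLp_four_iff {X : Ω → ℝ} (hX : AEStronglyMeasurable X P) :
    MemLp X 4 P ↔ Integrable (fun x => X x ^ 4) P := by
  rw [← integrable_norm_rpow_iff hX (by norm_num) (by norm_num)]
  have : (fun x => ‖X x‖ ^ (4 : ENNReal).toReal) = fun x => X x ^ 4 := by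
    funext x
    have : (4 : ENNReal).toReal = ((4 : ℕ) : ℝ) := by norm_num
    rw [this, Real.rpow_natCast, Real.norm_eq_abs, Even.pow_abs (by decide)]
  rw [this]

lemma MeasureTheory.MemLp.integrable_pow_four {X : Ω → ℝ} (hX : MemLp X 4 P) :
    Integrable (fun x => X x ^ 4) P := (memLp_four_iff hX.1).1 hX

lemma MeasureTheory.MemLp.mul_four {X Y : Ω → ℝ} (hX : MemLp X 4 P) (hY : MemLp Y 4 P) :
    MemLp (fun x => X x * Y x) 2 P := by
  have hm : AEStronglyMeasurable (fun x => X x * Y x) P := hX.1.mul hY.1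
  rw [memLp_two_iff_integrable_sq hm]
  refine (hX.integrable_pow_four.add hY.integrable_pow_four).mono' (hm.pow 2)
    (Eventually.of_forall fun x => ?_)
  simp only [Pi.add_apply]
  rw [Real.norm_of_nonneg (by positivity)]
  nlinarith [sq_nonneg (X x ^ 2 - Y x ^ 2), sq_nonneg (X x ^ 2), sq_nonneg (Y x ^ 2)]

lemma ProbabilityTheory.IndepFun.memLp_four_mul {X Y : Ω → ℝ} (h : IndepFun X Y P)
    (hX : MemLp X 4 P) (hY : MemLp Y 4 P) : MemLp (fun x => X x * Y x) 4 P := by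
  have hm : AEStronglyMeasurable (fun x => X x * Y x) P := hX.1.mul hY.1
  rw [memLp_four_iff hm]
  have h4 : IndepFun (fun x => X x ^ 4) (fun x => Y x ^ 4) P :=
    h.comp (φ := fun y => y ^ 4) (ψ := fun y => y ^ 4) (by fun_prop) (by fun_prop)
  have := h4.integrable_mul hX.integrable_pow_four hY.integrable_pow_four
  refine this.congr (Eventually.of_forall fun x => ?_)
  simp [mul_pow]

/-- Fourth moment of a martingale `∑ s, η s * Z s`, where `η s` is centred and independent of `Z s`
and of the earlier increments. The bound is quadratic in the number of terms. -/
lemma integral_pow_four_sum_le [IsProbabilityMeasure P] {ι : Type*} [LinearOrder ι]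
    {K : ι → MeasurableSpace Ω} (hK : ∀ s, K s ≤ mΩ) {η Z : ι → Ω → ℝ} {m B : ℝ} (hm : 1 ≤ m)
    (hη : ∀ s, MemLp (η s) 4 P)
    (hind : ∀ s, Indep (MeasurableSpace.comap (η s) inferInstance) (K s) P)
    (h0 : ∀ s, ∫ x, η s x ∂P = 0) (h4 : ∀ s, ∫ x, η s x ^ 4 ∂P ≤ m) (A : Finset ι)
    (hZK : ∀ s ∈ A, StronglyMeasurable[K s] (Z s)) (hZ : ∀ s ∈ A, MemLp (Z s) 4 P)
    (hB : ∀ s ∈ A, ∫ x, Z s x ^ 4 ∂P ≤ B)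
    (hpast : ∀ r ∈ A, ∀ s ∈ A, r < s → StronglyMeasurable[K s] (fun x => η r x * Z r x)) :
    MemLp (fun x => ∑ s ∈ A, η s x * Z s x) 4 P ∧
      ∫ x, (∑ s ∈ A, η s x * Z s x) ^ 4 ∂P ≤ 16 * m ^ 2 * (A.card : ℝ) ^ 2 * B := by
  have hif : ∀ s, ∀ W : Ω → ℝ, StronglyMeasurable[K s] W → IndepFun W (η s) P := fun s W hW =>
    (indep_of_indep_of_le_right (hind s) hW.measurable.comap_le).symm
  have hηZ : ∀ s ∈ A, MemLp (fun x => η s x * Z s x) 4 P := fun s hs =>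
    (hif s _ (hZK s hs)).symm.memLp_four_mul (hη s) (hZ s hs)
  induction A using Finset.induction_on_max with
  | empty => simp
  | insert a s hlt ih =>
    have has : a ∉ s := fun h => lt_irrefl _ (hlt a h)
    have haA : a ∈ insert a s := Finset.mem_insert_self a s
    have hsub : ∀ r ∈ s, r ∈ insert a s := fun r hr => Finset.mem_insert_of_mem hr
    obtain ⟨hS4, hSle⟩ := ih (fun r hr => hZK r (hsub r hr)) (fun r hr => hZ r (hsub r hr))
      (fun r hr => hB r (hsub r hr)) (fun r hr t ht => hpast r (hsub r hr) t (hsub t ht))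
      (fun r hr => hηZ r (hsub r hr))
    set S : Ω → ℝ := fun x => ∑ r ∈ s, η r x * Z r x with hS
    have hSK : StronglyMeasurable[K a] S :=
      Finset.stronglyMeasurable_fun_sum s fun r hr => hpast r (hsub r hr) a haA (hlt r hr)
    have hD4 := hηZ a haA
    have hZ4 := hZ a haA
    have hB0 : 0 ≤ B := (integral_nonneg fun x => by positivity).trans (hB a haA)
    have hsum : (fun x => ∑ r ∈ insert a s, η r x * Z r x)
        = fun x => S x + η a x * Z a x := by
      funext x; rw [Finset.sum_insert has, add_comm]
    have hcard : ((insert a s).card : ℝ) = s.card + 1 := by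
      rw [Finset.card_insert_of_notMem has]; push_cast; ring
    refine ⟨by rw [hsum]; exact hS4.add hD4, ?_⟩
    have hηm : AEStronglyMeasurable (η a) P := (hη a).1
    have hSZ2 : MemLp (fun x => S x * Z a x) 2 P := hS4.mul_four hZ4
    have i1 : Integrable (fun x => S x ^ 4) P := hS4.integrable_pow_four
    have iD : Integrable (fun x => (η a x * Z a x) ^ 4) P := hD4.integrable_pow_four
    have iZ : Integrable (fun x => Z a x ^ 4) P := hZ4.integrable_pow_four
    have i2 : Integrable (fun x => (S x ^ 3 * Z a x) * η a x) P := by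
      refine (i1.add iD).mono' (((hS4.1.pow 3).mul hZ4.1).mul hηm)
        (Eventually.of_forall fun x => ?_)
      simp only [Pi.add_apply, Real.norm_eq_abs]
      set u := S x
      set d := η a x * Z a x
      have e : u ^ 3 * Z a x * η a x = u ^ 3 * d := by simp only [d]; ring
      rw [e, abs_le]
      constructor <;>
      nlinarith [sq_nonneg (u ^ 2 - u * d), sq_nonneg (u ^ 2 + u * d), sq_nonneg (u ^ 2 - d ^ 2),
        sq_nonneg (u ^ 2 + d ^ 2), sq_nonneg (u ^ 2), sq_nonneg (d ^ 2)]
    have i3 : Integrable (fun x => (S x * Z a x) ^ 2 * η a x ^ 2) P := by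
      have := (hS4.mul_four hD4).integrable_sq
      refine this.congr (Eventually.of_forall fun x => ?_)
      simp only; ring
    have z2 : ∫ x, (S x ^ 3 * Z a x) * η a x ∂P = 0 := by
      have hW : StronglyMeasurable[K a] (fun x => S x ^ 3 * Z a x) := (hSK.pow 3).mul (hZK a haA)
      rw [(hif a _ hW).integral_fun_mul_eq_mul_integral (hW.mono (hK a)).aestronglyMeasurable hηm,
        h0 a, mul_zero]
    have eη2 : ∫ x, η a x ^ 2 ∂P ≤ m := by
      have hle : ∫ x, η a x ^ 2 ∂P ≤ ∫ x, (1 + η a x ^ 4) / 2 ∂P := by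
        refine integral_mono ((hη a).mono_exponent (p := 2) (by norm_num)).integrable_sq
          (((integrable_const _).add (hη a).integrable_pow_four).div_const 2) fun x => ?_
        simp only
        nlinarith [sq_nonneg (η a x ^ 2 - 1)]
      rw [integral_div, integral_add (integrable_const _) (hη a).integrable_pow_four] at hle
      simp only [integral_const, probReal_univ, smul_eq_mul, one_mul] at hle
      linarith [h4 a]
    have z3 : ∫ x, (S x * Z a x) ^ 2 * η a x ^ 2 ∂P ≤ m * ∫ x, (S x * Z a x) ^ 2 ∂P := by
      have hW : StronglyMeasurable[K a] (fun x => S x * Z a x) := hSK.mul (hZK a haA)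
      have h2 := (hif a _ hW).comp (φ := fun y => y ^ 2) (ψ := fun y => y ^ 2)
        (by fun_prop) (by fun_prop)
      have h3 := h2.integral_fun_mul_eq_mul_integral
        ((hW.mono (hK a)).aestronglyMeasurable.pow 2) (hηm.pow 2)
      simp only [Function.comp_apply] at h3
      rw [h3, mul_comm]
      exact mul_le_mul_of_nonneg_right eη2 (integral_nonneg fun x => by positivity)
    have z4 : ∫ x, (η a x * Z a x) ^ 4 ∂P ≤ m * B := by
      have h2 := (hif a _ (hZK a haA)).comp (φ := fun y => y ^ 4) (ψ := fun y => y ^ 4)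
        (by fun_prop) (by fun_prop)
      have h3 := h2.integral_fun_mul_eq_mul_integral (hZ4.1.pow 4) (hηm.pow 4)
      simp only [Function.comp_apply] at h3
      have : (fun x => (η a x * Z a x) ^ 4) = fun x => Z a x ^ 4 * η a x ^ 4 := by
        funext x; ring
      rw [this, h3, mul_comm]
      exact mul_le_mul (h4 a) (hB a haA) (integral_nonneg fun x => by positivity) (by linarith)
    rw [hcard]
    simp_rw [fun x => congrFun hsum x]
    rcases s.eq_empty_or_nonempty with rfl | hne
    · simp only [hS, Finset.sum_empty, zero_add, Finset.card_empty, Nat.cast_zero, one_pow, mul_one]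
      refine z4.trans (mul_le_mul_of_nonneg_right ?_ hB0)
      nlinarith
    · have hn : (0 : ℝ) < s.card := by exact_mod_cast hne.card_pos
      set n : ℝ := (s.card : ℝ) with hn_def
      have i12 : Integrable (fun x => S x ^ 4 + 4 * ((S x ^ 3 * Z a x) * η a x)) P :=
        i1.add (i2.const_mul 4)
      have i123 : Integrable (fun x => S x ^ 4 + 4 * ((S x ^ 3 * Z a x) * η a x)
          + 8 * ((S x * Z a x) ^ 2 * η a x ^ 2)) P := i12.add (i3.const_mul 8)
      -- expand, and absorb the cubic term by `4 S d³ ≤ 2 S² d² + 2 d⁴`, `d` the new increment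
      have step1 : ∫ x, (S x + η a x * Z a x) ^ 4 ∂P ≤ ∫ x, (S x ^ 4
          + 4 * ((S x ^ 3 * Z a x) * η a x) + 8 * ((S x * Z a x) ^ 2 * η a x ^ 2) + 3 * (η a x * Z a x) ^ 4) ∂P := by
        refine integral_mono (hS4.add hD4).integrable_pow_four
          (i123.add (iD.const_mul 3)) fun x => ?_
        simp only
        nlinarith [sq_nonneg ((S x - η a x * Z a x) * (η a x * Z a x))]
      -- Young's inequality, with the weights that let the quadratic bound reproduce itself:
      -- both terms become `2 m n B` under the induction hypothesis
      have step2 : ∫ x, (S x * Z a x) ^ 2 ∂P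
          ≤ (8 * m * n)⁻¹ * ∫ x, S x ^ 4 ∂P + 2 * m * n * ∫ x, Z a x ^ 4 ∂P := by
        rw [← integral_const_mul, ← integral_const_mul,
          ← integral_add (i1.const_mul _) (iZ.const_mul _)]
        refine integral_mono hSZ2.integrable_sq ((i1.const_mul _).add (iZ.const_mul _)) fun x => ?_
        simp only
        have hc : 0 < 8 * m * n := by positivity
        have : 0 ≤ (8 * m * n)⁻¹ * (S x ^ 2 - 4 * m * n * Z a x ^ 2) ^ 2 := by positivity
        have e : (8 * m * n)⁻¹ * (S x ^ 2 - 4 * m * n * Z a x ^ 2) ^ 2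
            = (8 * m * n)⁻¹ * S x ^ 4 + 2 * m * n * Z a x ^ 4 - (S x * Z a x) ^ 2 := by
          field_simp; ring
        linarith
      rw [integral_add i123 (iD.const_mul 3),
        integral_add i12 (i3.const_mul 8),
        integral_add i1 (i2.const_mul 4), integral_const_mul, integral_const_mul,
        integral_const_mul, z2] at step1
      have hBa := hB a haA
      have s3 : (8 * m * n)⁻¹ * ∫ x, S x ^ 4 ∂P ≤ (8 * m * n)⁻¹ * (16 * m ^ 2 * n ^ 2 * B) :=
        mul_le_mul_of_nonneg_left hSle (by positivity)
      have s4 : (8 * m * n)⁻¹ * (16 * m ^ 2 * n ^ 2 * B) = 2 * m * n * B := by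
        field_simp; ring
      have s5 : 2 * m * n * ∫ x, Z a x ^ 4 ∂P ≤ 2 * m * n * B :=
        mul_le_mul_of_nonneg_left hBa (by positivity)
      have s6 : ∫ x, (S x * Z a x) ^ 2 ∂P ≤ 4 * m * n * B := by linarith
      have s7 : m * ∫ x, (S x * Z a x) ^ 2 ∂P ≤ m * (4 * m * n * B) :=
        mul_le_mul_of_nonneg_left s6 (by linarith)
      have s8 : 3 * (m * B) ≤ 16 * m ^ 2 * B := by
        have : 3 * m ≤ 16 * m ^ 2 := by nlinarith
        nlinarith
      linarith

end FourthMoment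

/-! ### Averages over independent units -/

section IndependentUnits

variable {Ω : Type*} {F H m₂ : MeasurableSpace Ω} [mΩ : MeasurableSpace Ω] {P : Measure Ω}

/-- A weak law of large numbers: the average over `n` units of the products `X i * Y i`, centred at
their conditional expectations `R i` given the other units, has second moment `O(1 / n)`. -/
lemma integral_sq_average_le {n : ℕ} {H : Fin n → MeasurableSpace Ω} {X Y R : Fin n → Ω → ℝ} {B : ℝ}
    (hX : ∀ i, MemLp (X i) 4 P) (hY : ∀ i, MemLp (Y i) 4 P)
    (hR : ∀ i, MemLp (R i) 2 P) (hRH : ∀ i, StronglyMeasurable[H i] (R i))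
    (hDH : ∀ i j, j ≠ i → StronglyMeasurable[H i] (fun x => X j x * Y j x - R j x))
    (h0 : ∀ i, ∀ Z : Ω → ℝ, StronglyMeasurable[H i] Z → MemLp Z 2 P →
      ∫ x, Z x * (X i x * Y i x - R i x) ∂P = 0)
    (hXB : ∀ i, ∫ x, X i x ^ 4 ∂P ≤ B) (hYB : ∀ i, ∫ x, Y i x ^ 4 ∂P ≤ B) :
    ∫ x, ((1 / (n : ℝ)) * ∑ i, (X i x * Y i x - R i x)) ^ 2 ∂P ≤ B / n := by
  have hXY : ∀ i, MemLp (fun x => X i x * Y i x) 2 P := fun i => (hX i).mul_four (hY i)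
  have hD : ∀ i, MemLp (fun x => X i x * Y i x - R i x) 2 P := fun i => (hXY i).sub (hR i)
  have horth := integral_sq_sum_of_orthogonal Finset.univ
    (X := fun i x => X i x * Y i x - R i x) (P := P) (fun i _ => hD i)
    (fun i _ j _ hij => h0 j _ (hDH j i hij) (hD i))
  have hle : ∀ i, ∫ x, (X i x * Y i x - R i x) ^ 2 ∂P ≤ B := by
    intro i
    -- tested against `R i` itself, `h0` makes the second moment at most that of the product
    have hRD := h0 i (R i) (hRH i) (hR i)
    have i1 : Integrable (fun x => (X i x ^ 4 + Y i x ^ 4) / 2) P :=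
      ((hX i).integrable_pow_four.add (hY i).integrable_pow_four).div_const 2
    have i2 : Integrable (fun x => R i x * (X i x * Y i x - R i x)) P :=
      (hR i).integrable_mul (hD i)
    calc ∫ x, (X i x * Y i x - R i x) ^ 2 ∂P
        ≤ ∫ x, ((X i x ^ 4 + Y i x ^ 4) / 2 - 2 * (R i x * (X i x * Y i x - R i x))) ∂P := by
          refine integral_mono (hD i).integrable_sq (i1.sub (i2.const_mul 2)) fun x => ?_
          simp only
          nlinarith [sq_nonneg (X i x ^ 2 - Y i x ^ 2), sq_nonneg (R i x)]
      _ = (∫ x, X i x ^ 4 ∂P + ∫ x, Y i x ^ 4 ∂P) / 2 := by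
          rw [integral_sub i1 (i2.const_mul 2), integral_const_mul, hRD, integral_div,
            integral_add (hX i).integrable_pow_four (hY i).integrable_pow_four]
          ring
      _ ≤ B := by linarith [hXB i, hYB i]
  simp_rw [mul_pow]
  rw [integral_const_mul, horth]
  have hs : ∑ i, ∫ x, (X i x * Y i x - R i x) ^ 2 ∂P ≤ n * B := by
    simpa using Finset.sum_le_card_nsmul Finset.univ _ B fun i _ => hle i
  calc (1 / (n : ℝ)) ^ 2 * ∑ i, ∫ x, (X i x * Y i x - R i x) ^ 2 ∂P
      ≤ (1 / (n : ℝ)) ^ 2 * (n * B) := mul_le_mul_of_nonneg_left hs (by positivity)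
    _ = B / n := by
      rcases Nat.eq_zero_or_pos n with rfl | hn
      · simp
      · have : (n : ℝ) ≠ 0 := by positivity
        field_simp

variable [IsProbabilityMeasure P]

/-- Two linear combinations of functions `M p`, `N q` independent of `H`, with coefficients known
given `H`: the conditional expectation of their product given `H` is the bilinear form in the
coefficients whose matrix is `∫ M p * N q`. Stated in the form tested against `Z`. -/
lemma integral_mul_combination_eq_zero {I J : Type*} (A : Finset I) (B : Finset J)
    (hH : H ≤ mΩ) (h₂ : m₂ ≤ mΩ) (hind : Indep m₂ H P)
    {c M : I → Ω → ℝ} {d N : J → Ω → ℝ} {Z : Ω → ℝ} {ρ : I → J → ℝ}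
    (hcH : ∀ p ∈ A, StronglyMeasurable[H] (c p)) (hdH : ∀ q ∈ B, StronglyMeasurable[H] (d q))
    (hc : ∀ p ∈ A, MemLp (c p) 4 P) (hd : ∀ q ∈ B, MemLp (d q) 4 P)
    (hMm : ∀ p ∈ A, StronglyMeasurable[m₂] (M p)) (hNm : ∀ q ∈ B, StronglyMeasurable[m₂] (N q))
    (hM : ∀ p ∈ A, MemLp (M p) 4 P) (hN : ∀ q ∈ B, MemLp (N q) 4 P)
    (hρ : ∀ p ∈ A, ∀ q ∈ B, ∫ x, M p x * N q x ∂P = ρ p q)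
    (hZH : StronglyMeasurable[H] Z) (hZ : MemLp Z 2 P) :
    ∫ x, Z x * ((∑ p ∈ A, c p x * M p x) * (∑ q ∈ B, d q x * N q x)
      - ∑ p ∈ A, ∑ q ∈ B, c p x * d q x * ρ p q) ∂P = 0 := by
  have e : (fun x => Z x * ((∑ p ∈ A, c p x * M p x) * (∑ q ∈ B, d q x * N q x)
      - ∑ p ∈ A, ∑ q ∈ B, c p x * d q x * ρ p q))
      = fun x => ∑ p ∈ A, ∑ q ∈ B, (Z x * (c p x * d q x)) * (M p x * N q x - ρ p q) := by
    funext x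
    rw [Finset.sum_mul_sum, ← Finset.sum_sub_distrib, Finset.mul_sum]
    refine Finset.sum_congr rfl fun p _ => ?_
    rw [← Finset.sum_sub_distrib, Finset.mul_sum]
    refine Finset.sum_congr rfl fun q _ => ?_
    ring
  have hif : ∀ W V : Ω → ℝ, StronglyMeasurable[m₂] W → StronglyMeasurable[H] V →
      IndepFun V W P := fun W V hW hV =>
    (indep_of_indep_of_le_left (indep_of_indep_of_le_right hind hV.measurable.comap_le)
      hW.measurable.comap_le).symm
  have hint : ∀ p ∈ A, ∀ q ∈ B,
      Integrable (fun x => (Z x * (c p x * d q x)) * (M p x * N q x - ρ p q)) P := by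
    intro p hp q hq
    have h1 : MemLp (fun x => (c p x * M p x) * (d q x * N q x)) 2 P :=
      ((hif _ _ (hMm p hp) (hcH p hp)).memLp_four_mul (hc p hp) (hM p hp)).mul_four
        ((hif _ _ (hNm q hq) (hdH q hq)).memLp_four_mul (hd q hq) (hN q hq))
    have h2 : MemLp (fun x => c p x * d q x) 2 P := (hc p hp).mul_four (hd q hq)
    have h3 := (hZ.integrable_mul h1).sub ((hZ.integrable_mul h2).mul_const (ρ p q))
    refine h3.congr (Eventually.of_forall fun x => ?_)
    simp only [Pi.sub_apply, Pi.mul_apply]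
    ring
  rw [e, integral_finsetSum _ fun p hp => integrable_finsetSum _ fun q hq => hint p hp q hq]
  refine Finset.sum_eq_zero fun p hp => ?_
  rw [integral_finsetSum _ fun q hq => hint p hp q hq]
  refine Finset.sum_eq_zero fun q hq => ?_
  have hV : StronglyMeasurable[H] (fun x => Z x * (c p x * d q x)) :=
    hZH.mul ((hcH p hp).mul (hdH q hq))
  have hW : StronglyMeasurable[m₂] (fun x => M p x * N q x - ρ p q) :=
    ((hMm p hp).mul (hNm q hq)).sub stronglyMeasurable_const
  rw [(hif _ _ hW hV).integral_fun_mul_eq_mul_integral (hV.mono hH).aestronglyMeasurable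
    (hW.mono h₂).aestronglyMeasurable]
  have hMN : Integrable (fun x => M p x * N q x) P :=
    ((hM p hp).mul_four (hN q hq)).integrable (by norm_num)
  rw [integral_sub hMN (integrable_const _), hρ p hp q hq]
  simp

/-- Square-free monomials in independent centred variables are orthogonal. -/
lemma integral_prod_mul_prod {ι : Type*} [Fintype ι] [DecidableEq ι] {η : ι → Ω → ℝ} {v : ℝ}
    (hη : iIndepFun η P) (hm : ∀ s, AEMeasurable (η s) P) (h0 : ∀ s, ∫ x, η s x ∂P = 0)
    (h2 : ∀ s, ∫ x, η s x ^ 2 ∂P = v) (A B : Finset ι) :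
    ∫ x, (∏ s ∈ A, η s x) * (∏ s ∈ B, η s x) ∂P = if A = B then v ^ A.card else 0 := by
  set k : ι → ℕ := fun s => (if s ∈ A then 1 else 0) + (if s ∈ B then 1 else 0) with hk
  have e : (fun x => (∏ s ∈ A, η s x) * (∏ s ∈ B, η s x)) = fun x => ∏ s, η s x ^ k s := by
    funext x
    simp_rw [hk, pow_add, Finset.prod_mul_distrib, pow_ite, pow_one, pow_zero]
    simp
  rw [e, hη.integral_fun_prod_comp (f := fun s y => y ^ k s) hm
    (fun s => (continuous_pow (k s)).aestronglyMeasurable)]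
  split_ifs with hAB
  · subst hAB
    have : ∀ s, ∫ x, η s x ^ k s ∂P = if s ∈ A then v else 1 := by
      intro s
      by_cases hs : s ∈ A <;> simp [hk, hs, h2]
    simp [this]
  · obtain ⟨s, hs⟩ : ∃ s, ¬ (s ∈ A ↔ s ∈ B) := by
      by_contra h; push Not at h; exact hAB (Finset.ext h)
    refine Finset.prod_eq_zero (Finset.mem_univ s) ?_
    have : k s = 1 := by
      by_cases hA : s ∈ A <;> by_cases hB : s ∈ B <;> simp_all
    simp [this, h0]

end IndependentUnits

/-! ### Panels and their σ-algebras -/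

section Panels

variable {N T kv kw kγ kf : ℕ}

/-- The properties of a single panel that the argument uses, with all moment bounds expressed
through one constant `C`. -/
structure Panel.Regular (D : Panel N T kv kw kγ) (L : Latent D kf) (C : ℝ) : Prop where
  one_le : 1 ≤ C
  measurable_v : ∀ s, Measurable[D.F] (D.v s)
  measurable_w : ∀ s t, Measurable[D.F] (D.w s t)
  moment_v : ∀ s, Integrable (fun x => ‖D.v s x‖ ^ 4) D.P ∧ ∫ x, ‖D.v s x‖ ^ 4 ∂D.P ≤ C
  moment_w : ∀ s t, Integrable (fun x => ‖D.w s t x‖ ^ 4) D.P ∧ ∫ x, ‖D.w s t x‖ ^ 4 ∂D.P ≤ C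
  weights : ∀ i, ‖D.γ i‖ ≤ C
  decomposition : ∀ i t, ∀ᵐ x ∂D.P, D.e i t x = (∑ a, L.ld i a * L.f t x a) + L.η i t x
  serial_f : CondIndepFamily D.F D.P L.f
  condMean_f : ∀ t a, D.P[fun x => L.f t x a | D.F] =ᵐ[D.P] 0
  moment_vf : ∀ s t, Integrable (fun x => (‖D.v s x‖ ^ 4 + 1) * ‖L.f t x‖ ^ 4) D.P ∧
    ∫ x, (‖D.v s x‖ ^ 4 + 1) * ‖L.f t x‖ ^ 4 ∂D.P ≤ C
  moment_wf : ∀ s r t, Integrable (fun x => ‖D.w s r x‖ ^ 4 * ‖L.f t x‖ ^ 8) D.P ∧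
    ∫ x, ‖D.w s r x‖ ^ 4 * ‖L.f t x‖ ^ 8 ∂D.P ≤ C
  loadings : ∑ i, ‖L.ld i‖ ^ 2 ≤ C
  indep_η : iIndepFun (fun p : Fin N × Fin T => L.η p.1 p.2) D.P
  indep_η_common :
    Indep (⨆ p : Fin N × Fin T, MeasurableSpace.comap (L.η p.1 p.2) inferInstance)
      (D.F ⊔ ⨆ t, MeasurableSpace.comap (L.f t) inferInstance) D.P
  mean_η : ∀ i t, ∫ x, L.η i t x ∂D.P = 0
  second_η : ∀ i t, ∫ x, L.η i t x ^ 2 ∂D.P = L.σ i ^ 2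
  variance_le : ∀ i, L.σ i ^ 2 ≤ C
  moment_η : ∀ i t, MemLp (L.η i t) 4 D.P ∧ ∫ x, L.η i t x ^ 4 ∂D.P ≤ C

lemma sq_coord_le {k : ℕ} (u : EuclideanSpace ℝ (Fin k)) (a : Fin k) : u a ^ 2 ≤ ‖u‖ ^ 2 := by
  rw [EuclideanSpace.norm_sq_eq]
  have := Finset.single_le_sum (f := fun i => ‖u i‖ ^ 2) (fun i _ => by positivity)
    (Finset.mem_univ a)
  simpa using this

lemma pow_four_coord_le {k : ℕ} (u : EuclideanSpace ℝ (Fin k)) (a : Fin k) :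
    u a ^ 4 ≤ ‖u‖ ^ 4 := by
  have := sq_coord_le u a
  calc u a ^ 4 = (u a ^ 2) ^ 2 := by ring
    _ ≤ (‖u‖ ^ 2) ^ 2 := pow_le_pow_left₀ (by positivity) this 2
    _ = ‖u‖ ^ 4 := by ring

lemma sq_inner_coord_le {k : ℕ} (u v : EuclideanSpace ℝ (Fin k)) :
    (∑ a, u a * v a) ^ 2 ≤ ‖u‖ ^ 2 * ‖v‖ ^ 2 := by
  have := Finset.sum_mul_sq_le_sq_mul_sq Finset.univ (fun a => u a) (fun a => v a)
  simpa [EuclideanSpace.norm_sq_eq] using this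

/-- If all eigenvalues of `∑ i, π i (π i)'` are below `C`, then `∑ i, ‖π i‖² ≤ k C`. -/
lemma sum_norm_sq_le_of_spectrum {n k : ℕ} (u : Fin n → EuclideanSpace ℝ (Fin k)) {C : ℝ}
    (h : ∀ μ ∈ spectrum ℝ (∑ i, outer (u i)), μ < C) : ∑ i, ‖u i‖ ^ 2 ≤ k * C := by
  have hH : (∑ i, outer (u i)).IsHermitian := by
    ext a b
    simp [outer, Matrix.sum_apply, mul_comm]
  have htr : (∑ i, outer (u i)).trace = ∑ i, ‖u i‖ ^ 2 := by
    rw [Matrix.trace_sum]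
    simp [Matrix.trace, outer, EuclideanSpace.norm_sq_eq, ← sq]
  rw [← htr, hH.trace_eq_sum_eigenvalues]
  have := Finset.sum_le_card_nsmul Finset.univ (fun i => hH.eigenvalues i) C
    fun i _ => (h _ (hH.eigenvalues_mem_spectrum_real i)).le
  simpa using this

lemma exists_regular (D : ∀ N T : ℕ, Panel N T kv kw kγ) (L : ∀ N T : ℕ, Latent (D N T) kf)
    {Ωv : Matrix (Fin kv) (Fin kv) ℝ} {Ωw : Matrix (Fin kw) (Fin kw) ℝ}
    {Γπγ : Matrix (Fin kf) (Fin kγ) ℝ} {Γω : Matrix (Fin kγ) (Fin kγ) ℝ} {ω : ℝ}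
    {Sfv : Matrix (Fin kf × Fin kv) (Fin kf × Fin kv) ℝ}
    (hcommon : CommonVariables D Ωv Ωw) (hweights : BoundedWeights D)
    (hfactor : WeakFactorStructure D L Γπγ Γω ω Sfv) :
    ∃ C : ℝ, ∀ N T, (D N T).Regular (L N T) C := by
  obtain ⟨C₁, h₁⟩ := hcommon.moment_v
  obtain ⟨C₂, h₂⟩ := hcommon.moment_w
  obtain ⟨C₃, h₃⟩ := hweights
  obtain ⟨C₄, h₄⟩ := hfactor.moment_vf
  obtain ⟨C₅, h₅⟩ := hfactor.moment_wf
  obtain ⟨C₆, h₆⟩ := hfactor.weak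
  obtain ⟨C₇, h₇⟩ := hfactor.bounded_variance
  obtain ⟨C₈, h₈⟩ := hfactor.moment_η
  have hle : ∃ C : ℝ, 1 ≤ C ∧ C₁ ≤ C ∧ C₂ ≤ C ∧ C₃ ≤ C ∧ C₄ ≤ C ∧ C₅ ≤ C ∧ kf * C₆ ≤ C ∧
      C₇ ≤ C ∧ C₈ ≤ C := by
    refine ⟨1 + |C₁| + |C₂| + |C₃| + |C₄| + |C₅| + |kf * C₆| + |C₇| + |C₈|, ?_⟩
    refine ⟨?_, ?_, ?_, ?_, ?_, ?_, ?_, ?_, ?_⟩ <;>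
    linarith [abs_nonneg C₁, abs_nonneg C₂, abs_nonneg C₃, abs_nonneg C₄, abs_nonneg C₅,
      abs_nonneg (kf * C₆), abs_nonneg C₇, abs_nonneg C₈, le_abs_self C₁, le_abs_self C₂,
      le_abs_self C₃, le_abs_self C₄, le_abs_self C₅, le_abs_self (kf * C₆), le_abs_self C₇,
      le_abs_self C₈]
  obtain ⟨C, c0, c1, c2, c3, c4, c5, c6, c7, c8⟩ := hle
  refine ⟨C, fun N T => ?_⟩
  have hη4 : ∀ i t, MemLp ((L N T).η i t) 4 (D N T).P := fun i t =>
    (memLp_four_iff ((L N T).measurable_η i t).aestronglyMeasurable).2 (h₈ N T i t).1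
  exact
    { one_le := c0
      measurable_v := hcommon.measurable_v N T
      measurable_w := hcommon.measurable_w N T
      moment_v := fun s => ⟨(h₁ N T s).1, (h₁ N T s).2.le.trans c1⟩
      moment_w := fun s t => ⟨(h₂ N T s t).1, (h₂ N T s t).2.le.trans c2⟩
      weights := fun i => (h₃ N T i).le.trans c3
      decomposition := hfactor.decomposition N T
      serial_f := hfactor.serial_f N T
      condMean_f := hfactor.condMean_f N T
      moment_vf := fun s t => ⟨(h₄ N T s t).1, (h₄ N T s t).2.le.trans c4⟩
      moment_wf := fun s r t => ⟨(h₅ N T s r t).1, (h₅ N T s r t).2.le.trans c5⟩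
      loadings := (sum_norm_sq_le_of_spectrum _ (h₆ N T)).trans c6
      indep_η := hfactor.indep_η N T
      indep_η_common := hfactor.indep_η_common N T
      mean_η := hfactor.mean_η N T
      second_η := fun i t => by
        rw [← hfactor.variance_η N T i t, variance_of_integral_eq_zero
          ((L N T).measurable_η i t).aemeasurable (hfactor.mean_η N T i t)]
      variance_le := fun i => (h₇ N T i).le.trans c7
      moment_η := fun i t => ⟨hη4 i t, (h₈ N T i t).2.le.trans c8⟩ }

namespace Latent

variable {D : Panel N T kv kw kγ} (L : Latent D kf)

/-- The σ-algebra of the common shocks and the factors. -/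
@[reducible] def common : MeasurableSpace D.Ω :=
  D.F ⊔ ⨆ t, MeasurableSpace.comap (L.f t) inferInstance

/-- The σ-algebra of the remainders with index in `S`. -/
@[reducible] def remainders (S : Set (Fin N × Fin T)) : MeasurableSpace D.Ω :=
  ⨆ p ∈ S, MeasurableSpace.comap (L.η p.1 p.2) inferInstance

/-- The σ-algebra of the common shocks, the factors, and the remainders with index outside `S`. -/
@[reducible] def except (S : Set (Fin N × Fin T)) : MeasurableSpace D.Ω :=
  L.common ⊔ L.remainders Sᶜ

/-- The σ-algebra of the common shocks, and of the factors and remainders at times other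
than `t`. -/
@[reducible] def exceptTime (t : Fin T) : MeasurableSpace D.Ω :=
  (D.F ⊔ ⨆ r ∈ ({t}ᶜ : Set (Fin T)), MeasurableSpace.comap (L.f r) inferInstance) ⊔
    L.remainders {p | p.2 ≠ t}

/-- The factor component `π i' f t` of the error. -/
def factorPart (i : Fin N) (t : Fin T) (x : D.Ω) : ℝ := ∑ a, L.ld i a * L.f t x a

lemma common_le : L.common ≤ D.mΩ :=
  sup_le D.F_le (iSup_le fun t => (L.measurable_f t).comap_le)

lemma remainders_le (S : Set (Fin N × Fin T)) : L.remainders S ≤ D.mΩ :=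
  iSup₂_le fun p _ => (L.measurable_η p.1 p.2).comap_le

lemma except_le (S : Set (Fin N × Fin T)) : L.except S ≤ D.mΩ :=
  sup_le L.common_le (L.remainders_le _)

lemma exceptTime_le (t : Fin T) : L.exceptTime t ≤ D.mΩ :=
  sup_le (sup_le D.F_le (iSup₂_le fun r _ => (L.measurable_f r).comap_le)) (L.remainders_le _)

lemma F_le_common : D.F ≤ L.common := le_sup_left

lemma common_le_except (S : Set (Fin N × Fin T)) : L.common ≤ L.except S := le_sup_left

lemma F_le_except (S : Set (Fin N × Fin T)) : D.F ≤ L.except S :=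
  L.F_le_common.trans (L.common_le_except S)

lemma F_le_exceptTime (t : Fin T) : D.F ≤ L.exceptTime t := le_sup_left.trans le_sup_left

lemma exceptTime_le_except (i : Fin N) (t : Fin T) : L.exceptTime t ≤ L.except {(i, t)} := by
  refine sup_le (le_sup_left.trans' (sup_le_sup_left (iSup₂_le fun r _ => le_iSup
    (fun r => MeasurableSpace.comap (L.f r) inferInstance) r) _)) (le_sup_right.trans' ?_)
  refine biSup_mono fun p hp => ?_
  rintro rfl
  exact hp rfl

lemma stronglyMeasurable_η {S : Set (Fin N × Fin T)} {i : Fin N} {t : Fin T} (h : (i, t) ∈ S) :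
    StronglyMeasurable[L.remainders S] (L.η i t) := by
  have : Measurable[MeasurableSpace.comap (L.η i t) inferInstance] (L.η i t) :=
    comap_measurable _
  refine (this.mono ?_ le_rfl).stronglyMeasurable
  exact le_iSup₂ (f := fun (p : Fin N × Fin T) (_ : p ∈ S) =>
    MeasurableSpace.comap (L.η p.1 p.2) inferInstance) (i, t) h

lemma stronglyMeasurable_η_except {S : Set (Fin N × Fin T)} {i : Fin N} {t : Fin T}
    (h : (i, t) ∉ S) : StronglyMeasurable[L.except S] (L.η i t) :=
  (L.stronglyMeasurable_η (S := Sᶜ) h).mono le_sup_right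

lemma stronglyMeasurable_η_exceptTime {i : Fin N} {r t : Fin T} (h : r ≠ t) :
    StronglyMeasurable[L.exceptTime t] (L.η i r) :=
  (L.stronglyMeasurable_η (S := {p | p.2 ≠ t}) h).mono le_sup_right

lemma stronglyMeasurable_factorPart (i : Fin N) (t : Fin T) :
    StronglyMeasurable[MeasurableSpace.comap (L.f t) inferInstance] (L.factorPart i t) := by
  have h : Measurable (fun u : EuclideanSpace ℝ (Fin kf) => ∑ a, L.ld i a * u a) := by
    fun_prop
  exact (h.comp (comap_measurable (L.f t))).stronglyMeasurable

lemma stronglyMeasurable_factorPart_common (i : Fin N) (t : Fin T) :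
    StronglyMeasurable[L.common] (L.factorPart i t) :=
  (L.stronglyMeasurable_factorPart i t).mono (le_sup_right.trans' (le_iSup
    (fun r => MeasurableSpace.comap (L.f r) inferInstance) t))

lemma stronglyMeasurable_factorPart_exceptTime (i : Fin N) {r t : Fin T} (h : r ≠ t) :
    StronglyMeasurable[L.exceptTime t] (L.factorPart i r) :=
  (L.stronglyMeasurable_factorPart i r).mono
    ((le_sup_right.trans' (le_iSup₂ (f := fun (r : Fin T) (_ : r ∈ ({t}ᶜ : Set (Fin T))) =>
      MeasurableSpace.comap (L.f r) inferInstance) r h)).trans le_sup_left)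

lemma aestronglyMeasurable_factorPart (i : Fin N) (t : Fin T) :
    AEStronglyMeasurable (L.factorPart i t) D.P :=
  ((L.stronglyMeasurable_factorPart_common i t).mono L.common_le).aestronglyMeasurable

lemma sq_factorPart_le (i : Fin N) (t : Fin T) (x : D.Ω) :
    L.factorPart i t x ^ 2 ≤ ‖L.ld i‖ ^ 2 * ‖L.f t x‖ ^ 2 := sq_inner_coord_le _ _

end Latent

namespace Panel.Regular

variable {D : Panel N T kv kw kγ} {L : Latent D kf} {C : ℝ} (h : D.Regular L C)

include h

lemma indep_remainders (S : Set (Fin N × Fin T)) : Indep (L.remainders S) (L.except S) D.P := by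
  refine indep_sup_right_of_indep L.common_le (L.remainders_le S) (L.remainders_le Sᶜ) ?_ ?_
  · exact indep_iSup_of_disjoint
      (m := fun p : Fin N × Fin T => MeasurableSpace.comap (L.η p.1 p.2) inferInstance)
      (fun p => (L.measurable_η p.1 p.2).comap_le) h.indep_η.iIndep disjoint_compl_right
  · refine indep_of_indep_of_le_left h.indep_η_common ?_
    refine sup_le ?_ ?_ <;>
    exact iSup₂_le fun p _ => le_iSup
      (fun p : Fin N × Fin T => MeasurableSpace.comap (L.η p.1 p.2) inferInstance) p

lemma condExp_η (i : Fin N) (t : Fin T) : D.P[L.η i t | L.exceptTime t] =ᵐ[D.P] 0 := by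
  refine condExp_eq_zero_mono (L.except_le {(i, t)}) (L.exceptTime_le_except i t) ?_
  refine (condExp_indep_eq (L.remainders_le {(i, t)}) (L.except_le _)
    (L.stronglyMeasurable_η rfl) (h.indep_remainders _)).trans (Eventually.of_forall fun x => ?_)
  simp [h.mean_η i t]

lemma integrable_f_pow_four (t : Fin T) : Integrable (fun x => ‖L.f t x‖ ^ 4) D.P := by
  refine (h.moment_vf t t).1.mono'
    ((L.measurable_f t).norm.pow_const 4).aestronglyMeasurable (Eventually.of_forall fun x => ?_)
  rw [Real.norm_of_nonneg (by positivity)]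
  nlinarith [pow_nonneg (norm_nonneg (D.v t x)) 4, pow_nonneg (norm_nonneg (L.f t x)) 4,
    mul_nonneg (pow_nonneg (norm_nonneg (D.v t x)) 4) (pow_nonneg (norm_nonneg (L.f t x)) 4)]

lemma integrable_f (t : Fin T) (a : Fin kf) : Integrable (fun x => L.f t x a) D.P := by
  have hm : Measurable (fun x => L.f t x a) := by have := L.measurable_f t; fun_prop
  refine ((integrable_const (1 : ℝ)).add (h.integrable_f_pow_four t)).mono'
    hm.aestronglyMeasurable (Eventually.of_forall fun x => ?_)
  have h4 := pow_four_coord_le (L.f t x) a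
  simp only [Pi.add_apply, Real.norm_eq_abs, abs_le]
  set y := L.f t x a
  constructor <;> nlinarith [sq_nonneg (y ^ 2 - 1), sq_nonneg (y - 1), sq_nonneg (y + 1)]

lemma integrable_factorPart (i : Fin N) (t : Fin T) : Integrable (L.factorPart i t) D.P :=
  integrable_finsetSum _ fun a _ => (h.integrable_f t a).const_mul _

lemma condExp_factorPart (i : Fin N) (t : Fin T) :
    D.P[L.factorPart i t | L.exceptTime t] =ᵐ[D.P] 0 := by
  have hF : D.P[L.factorPart i t | D.F] =ᵐ[D.P] 0 := by
    have e : L.factorPart i t = ∑ a, L.ld i a • fun x => L.f t x a := by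
      funext x; simp [Latent.factorPart]
    rw [e]
    refine (condExp_finsetSum (fun a _ => (h.integrable_f t a).smul _) D.F).trans ?_
    have : ∀ a, D.P[L.ld i a • fun x => L.f t x a | D.F] =ᵐ[D.P] 0 := fun a => by
      refine (condExp_smul (L.ld i a) _ D.F).trans ?_
      filter_upwards [h.condMean_f t a] with x hx
      simp [hx]
    filter_upwards [ae_all_iff.2 this] with x hx
    simp [hx]
  have h1 := h.serial_f.condExp_eq_zero D.F_le L.measurable_f t
    (L.stronglyMeasurable_factorPart i t) (h.integrable_factorPart i t) hF
  have hle : ∀ S, L.remainders S ≤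
      ⨆ p : Fin N × Fin T, MeasurableSpace.comap (L.η p.1 p.2) inferInstance := fun S =>
    iSup₂_le fun p _ => le_iSup
      (fun p : Fin N × Fin T => MeasurableSpace.comap (L.η p.1 p.2) inferInstance) p
  exact condExp_sup_eq_zero_of_indep (m₃ := L.common)
    (sup_le_sup_left (iSup₂_le fun r _ => le_iSup
      (fun r => MeasurableSpace.comap (L.f r) inferInstance) r) _)
    (L.remainders_le _) L.common_le (indep_of_indep_of_le_left h.indep_η_common (hle _))
    (L.stronglyMeasurable_factorPart_common i t) (h.integrable_factorPart i t) h1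

end Panel.Regular

end Panels

/-! ### Moments of the summands of one unit -/

lemma memLp_two_of_sq_le {Ω : Type*} [MeasurableSpace Ω] {P : Measure Ω} {g G : Ω → ℝ} {B : ℝ}
    (hg : AEStronglyMeasurable g P) (hG : Integrable G P) (hle : ∀ x, g x ^ 2 ≤ G x)
    (hB : ∫ x, G x ∂P ≤ B) : MemLp g 2 P ∧ ∫ x, g x ^ 2 ∂P ≤ B := by
  have hi : Integrable (fun x => g x ^ 2) P := by
    refine hG.mono' (hg.pow 2) (Eventually.of_forall fun x => ?_)
    rw [Real.norm_of_nonneg (sq_nonneg _)]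
    exact hle x
  exact ⟨(memLp_two_iff_integrable_sq hg).2 hi, (integral_mono hi hG hle).trans hB⟩

section Units

variable {N T kv kw kγ kf : ℕ}

/-- The vector `ξ i` as a function of the errors `u` of the unit. -/
noncomputable def Panel.score (D : Panel N T kv kw kγ) (i : Fin N) (u : Fin T → D.Ω → ℝ)
    (x : D.Ω) : (Fin kγ × Fin kv) ⊕ Fin kw → ℝ :=
  Sum.elim
    (fun p => (1 / √(T : ℝ)) * ∑ s, D.γ i p.1 * D.v s x p.2 * u s x)
    (fun j => (1 / (T : ℝ)) * ∑ s, ∑ t ∈ Finset.Iio s, D.w s t x j * (u t x * u s x))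

lemma one_div_pow_mul_pow_le_one (n k : ℕ) : (1 / (n : ℝ)) ^ k * (n : ℝ) ^ k ≤ 1 := by
  rw [← mul_pow]
  refine pow_le_one₀ (by positivity) ?_
  rcases Nat.eq_zero_or_pos n with rfl | hn
  · simp
  · have : (n : ℝ) ≠ 0 := by positivity
    field_simp; rfl

lemma one_div_sqrt_sq (n : ℕ) : (1 / √(n : ℝ)) ^ 2 = 1 / n := by
  rw [div_pow, one_pow, Real.sq_sqrt (Nat.cast_nonneg n)]

lemma card_Iio_le (s : Fin T) : ((Finset.Iio s).card : ℝ) ≤ T := by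
  have := (Finset.card_le_univ (Finset.Iio s))
  rw [Fintype.card_fin] at this
  exact_mod_cast this

namespace Panel.Regular

variable {D : Panel N T kv kw kγ} {L : Latent D kf} {C : ℝ} (h : D.Regular L C)

include h

lemma stronglyMeasurable_v (s : Fin T) (q : Fin kv) :
    StronglyMeasurable[D.F] (fun x => D.v s x q) := by
  have hm : Measurable (fun u : EuclideanSpace ℝ (Fin kv) => u q) := by fun_prop
  exact (hm.comp (h.measurable_v s)).stronglyMeasurable

lemma stronglyMeasurable_w (s t : Fin T) (j : Fin kw) :
    StronglyMeasurable[D.F] (fun x => D.w s t x j) := by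
  have hm : Measurable (fun u : EuclideanSpace ℝ (Fin kw) => u j) := by fun_prop
  exact (hm.comp (h.measurable_w s t)).stronglyMeasurable

lemma memLp_v (s : Fin T) (q : Fin kv) : MemLp (fun x => D.v s x q) 4 D.P ∧
    ∫ x, D.v s x q ^ 4 ∂D.P ≤ C := by
  have hm := ((h.stronglyMeasurable_v s q).mono D.F_le).aestronglyMeasurable (μ := D.P)
  have hle : ∀ x, D.v s x q ^ 4 ≤ ‖D.v s x‖ ^ 4 := fun x => pow_four_coord_le _ _
  have hi : Integrable (fun x => D.v s x q ^ 4) D.P := by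
    refine (h.moment_v s).1.mono' (hm.pow 4) (Eventually.of_forall fun x => ?_)
    rw [Real.norm_of_nonneg (by positivity)]
    exact hle x
  exact ⟨(memLp_four_iff hm).2 hi, (integral_mono hi (h.moment_v s).1 hle).trans (h.moment_v s).2⟩

lemma memLp_w (s t : Fin T) (j : Fin kw) : MemLp (fun x => D.w s t x j) 4 D.P ∧
    ∫ x, D.w s t x j ^ 4 ∂D.P ≤ C := by
  have hm := ((h.stronglyMeasurable_w s t j).mono D.F_le).aestronglyMeasurable (μ := D.P)
  have hle : ∀ x, D.w s t x j ^ 4 ≤ ‖D.w s t x‖ ^ 4 := fun x => pow_four_coord_le _ _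
  have hi : Integrable (fun x => D.w s t x j ^ 4) D.P := by
    refine (h.moment_w s t).1.mono' (hm.pow 4) (Eventually.of_forall fun x => ?_)
    rw [Real.norm_of_nonneg (by positivity)]
    exact hle x
  exact ⟨(memLp_four_iff hm).2 hi,
    (integral_mono hi (h.moment_w s t).1 hle).trans (h.moment_w s t).2⟩

lemma weight_sq_le (i : Fin N) (p : Fin kγ) : D.γ i p ^ 2 ≤ C ^ 2 :=
  (sq_coord_le _ _).trans (pow_le_pow_left₀ (norm_nonneg _) (h.weights i) 2)

lemma loading_sq_le (i : Fin N) : ‖L.ld i‖ ^ 2 ≤ C :=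
  (Finset.single_le_sum (f := fun i => ‖L.ld i‖ ^ 2) (fun i _ => by positivity)
    (Finset.mem_univ i)).trans h.loadings

lemma indep_single (i : Fin N) (t : Fin T) :
    Indep (MeasurableSpace.comap (L.η i t) inferInstance) (L.except {(i, t)}) D.P :=
  indep_of_indep_of_le_left (h.indep_remainders {(i, t)})
    (L.stronglyMeasurable_η (S := {(i, t)}) rfl).measurable.comap_le

/-- The part of `ξ i` that comes from the remainders has bounded fourth moments. -/
lemma score_remainder_moment (i : Fin N) (a : (Fin kγ × Fin kv) ⊕ Fin kw) :
    MemLp (fun x => D.score i (L.η i) x a) 4 D.P ∧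
      ∫ x, D.score i (L.η i) x a ^ 4 ∂D.P ≤ 256 * C ^ 7 := by
  have hC := h.one_le
  have hC0 : 0 ≤ C := by linarith
  have base := fun (A : Finset (Fin T)) (Z : Fin T → D.Ω → ℝ) (B : ℝ) =>
    integral_pow_four_sum_le (P := D.P) (K := fun t => L.except {(i, t)})
      (fun t => L.except_le _) (η := L.η i) (Z := Z) (B := B) hC (fun t => (h.moment_η i t).1)
      (fun t => h.indep_single i t) (h.mean_η i) (fun t => (h.moment_η i t).2) A
  rcases a with ⟨p, q⟩ | j
  · have hF : ∀ s, StronglyMeasurable[D.F] (fun x => D.γ i p * D.v s x q) := fun s =>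
      stronglyMeasurable_const.mul (h.stronglyMeasurable_v s q)
    have hZ : ∀ s, MemLp (fun x => D.γ i p * D.v s x q) 4 D.P := fun s =>
      (h.memLp_v s q).1.const_mul _
    have hB : ∀ s, ∫ x, (D.γ i p * D.v s x q) ^ 4 ∂D.P ≤ C ^ 5 := fun s => by
      simp_rw [mul_pow]
      rw [integral_const_mul]
      have h1 : D.γ i p ^ 4 ≤ C ^ 4 := by
        have := pow_le_pow_left₀ (sq_nonneg _) (h.weight_sq_le i p) 2
        calc D.γ i p ^ 4 = (D.γ i p ^ 2) ^ 2 := by ring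
          _ ≤ (C ^ 2) ^ 2 := this
          _ = C ^ 4 := by ring
      calc D.γ i p ^ 4 * ∫ x, D.v s x q ^ 4 ∂D.P ≤ C ^ 4 * C :=
            mul_le_mul h1 (h.memLp_v s q).2 (integral_nonneg fun x => by positivity)
              (by positivity)
        _ = C ^ 5 := by ring
    obtain ⟨hm, hle⟩ := base Finset.univ (fun s x => D.γ i p * D.v s x q) (C ^ 5)
      (fun s _ => (hF s).mono (L.F_le_except _)) (fun s _ => hZ s) (fun s _ => hB s)
      (fun r _ s _ hrs => (L.stronglyMeasurable_η_except (by simp [hrs.ne])).mul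
        ((hF r).mono (L.F_le_except _)))
    have e : (fun x => D.score i (L.η i) x (Sum.inl (p, q)))
        = fun x => (1 / √(T : ℝ)) * ∑ s, L.η i s x * (D.γ i p * D.v s x q) := by
      funext x
      simp [Panel.score, mul_comm]
    refine ⟨by rw [e]; exact hm.const_mul _, ?_⟩
    simp_rw [fun x => congrFun e x, mul_pow]
    rw [integral_const_mul]
    rw [Finset.card_univ, Fintype.card_fin] at hle
    have hT : (1 / √(T : ℝ)) ^ 4 * (T : ℝ) ^ 2 ≤ 1 := by
      rw [show (1 / √(T : ℝ)) ^ 4 = ((1 / √(T : ℝ)) ^ 2) ^ 2 by ring, one_div_sqrt_sq]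
      exact one_div_pow_mul_pow_le_one T 2
    calc (1 / √(T : ℝ)) ^ 4 * ∫ x, (∑ s, L.η i s x * (D.γ i p * D.v s x q)) ^ 4 ∂D.P
        ≤ (1 / √(T : ℝ)) ^ 4 * (16 * C ^ 2 * (T : ℝ) ^ 2 * C ^ 5) :=
          mul_le_mul_of_nonneg_left hle (by positivity)
      _ = ((1 / √(T : ℝ)) ^ 4 * (T : ℝ) ^ 2) * (16 * C ^ 7) := by ring
      _ ≤ 1 * (16 * C ^ 7) := mul_le_mul_of_nonneg_right hT (by positivity)
      _ ≤ 256 * C ^ 7 := by nlinarith [pow_nonneg hC0 7]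
  · -- both the inner sums over `t < s` and the outer sum over `s` are martingales
    have hin : ∀ s, MemLp (fun x => ∑ t ∈ Finset.Iio s, L.η i t x * D.w s t x j) 4 D.P ∧
        ∫ x, (∑ t ∈ Finset.Iio s, L.η i t x * D.w s t x j) ^ 4 ∂D.P
          ≤ 16 * C ^ 3 * (T : ℝ) ^ 2 := fun s => by
      obtain ⟨hm, hle⟩ := base (Finset.Iio s) (fun t x => D.w s t x j) C
        (fun t _ => (h.stronglyMeasurable_w s t j).mono (L.F_le_except _))
        (fun t _ => (h.memLp_w s t j).1) (fun t _ => (h.memLp_w s t j).2)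
        (fun r _ t _ hrt => (L.stronglyMeasurable_η_except (by simp [hrt.ne])).mul
          ((h.stronglyMeasurable_w s r j).mono (L.F_le_except _)))
      refine ⟨hm, hle.trans ?_⟩
      have := pow_le_pow_left₀ (Nat.cast_nonneg _) (card_Iio_le s) 2
      calc 16 * C ^ 2 * ((Finset.Iio s).card : ℝ) ^ 2 * C
          = 16 * C ^ 3 * ((Finset.Iio s).card : ℝ) ^ 2 := by ring
        _ ≤ 16 * C ^ 3 * (T : ℝ) ^ 2 := mul_le_mul_of_nonneg_left this (by positivity)
    have hK : ∀ r s, r ≤ s → StronglyMeasurable[L.except {(i, s)}]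
        (fun x => ∑ t ∈ Finset.Iio r, L.η i t x * D.w r t x j) := fun r s hrs =>
      Finset.stronglyMeasurable_fun_sum _ fun t ht =>
        (L.stronglyMeasurable_η_except (by
          simp [((Finset.mem_Iio.1 ht).trans_le hrs).ne])).mul
          ((h.stronglyMeasurable_w r t j).mono (L.F_le_except _))
    obtain ⟨hm, hle⟩ := base Finset.univ
      (fun s x => ∑ t ∈ Finset.Iio s, L.η i t x * D.w s t x j) (16 * C ^ 3 * (T : ℝ) ^ 2)
      (fun s _ => hK s s le_rfl) (fun s _ => (hin s).1) (fun s _ => (hin s).2)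
      (fun r _ s _ hrs => (L.stronglyMeasurable_η_except (by simp [hrs.ne])).mul
        (hK r s hrs.le))
    have e : (fun x => D.score i (L.η i) x (Sum.inr j))
        = fun x => (1 / (T : ℝ)) * ∑ s, L.η i s x *
            ∑ t ∈ Finset.Iio s, L.η i t x * D.w s t x j := by
      funext x
      simp only [Panel.score, Sum.elim_inr, Finset.mul_sum]
      refine Finset.sum_congr rfl fun s _ => Finset.sum_congr rfl fun t _ => by ring
    refine ⟨by rw [e]; exact hm.const_mul _, ?_⟩
    simp_rw [fun x => congrFun e x, mul_pow]
    rw [integral_const_mul]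
    rw [Finset.card_univ, Fintype.card_fin] at hle
    calc (1 / (T : ℝ)) ^ 4 * ∫ x, (∑ s, L.η i s x *
            ∑ t ∈ Finset.Iio s, L.η i t x * D.w s t x j) ^ 4 ∂D.P
        ≤ (1 / (T : ℝ)) ^ 4 * (16 * C ^ 2 * (T : ℝ) ^ 2 * (16 * C ^ 3 * (T : ℝ) ^ 2)) :=
          mul_le_mul_of_nonneg_left hle (by positivity)
      _ = ((1 / (T : ℝ)) ^ 4 * (T : ℝ) ^ 4) * (256 * C ^ 5) := by ring
      _ ≤ 1 * (256 * C ^ 5) :=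
          mul_le_mul_of_nonneg_right (one_div_pow_mul_pow_le_one T 4) (by positivity)
      _ ≤ 256 * C ^ 7 := by
          have := pow_le_pow_right₀ hC (show 5 ≤ 7 by norm_num)
          linarith

lemma memLp_v_mul_factorPart (i : Fin N) (s t : Fin T) (q : Fin kv) :
    MemLp (fun x => D.v s x q * L.factorPart i t x) 2 D.P ∧
      ∫ x, (D.v s x q * L.factorPart i t x) ^ 2 ∂D.P ≤ ‖L.ld i‖ ^ 2 * (1 + C) := by
  obtain ⟨hi, hle⟩ := h.moment_vf s t
  have hi' : Integrable (fun x => 1 + (‖D.v s x‖ ^ 4 + 1) * ‖L.f t x‖ ^ 4) D.P :=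
    (integrable_const (1 : ℝ)).add hi
  refine memLp_two_of_sq_le
    (((h.stronglyMeasurable_v s q).mono D.F_le).aestronglyMeasurable.mul
      (L.aestronglyMeasurable_factorPart i t)) (hi'.const_mul (‖L.ld i‖ ^ 2)) (fun x => ?_) ?_
  · rw [mul_pow]
    have h1 := sq_coord_le (D.v s x) q
    have h2 := L.sq_factorPart_le i t x
    calc D.v s x q ^ 2 * L.factorPart i t x ^ 2
        ≤ ‖D.v s x‖ ^ 2 * (‖L.ld i‖ ^ 2 * ‖L.f t x‖ ^ 2) :=
          mul_le_mul h1 h2 (sq_nonneg _) (sq_nonneg _)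
      _ = ‖L.ld i‖ ^ 2 * (‖D.v s x‖ ^ 2 * ‖L.f t x‖ ^ 2) := by ring
      _ ≤ ‖L.ld i‖ ^ 2 * (1 + (‖D.v s x‖ ^ 4 + 1) * ‖L.f t x‖ ^ 4) := by
          refine mul_le_mul_of_nonneg_left ?_ (sq_nonneg _)
          nlinarith [sq_nonneg (‖D.v s x‖ ^ 2 * ‖L.f t x‖ ^ 2 - 1), sq_nonneg (‖L.f t x‖ ^ 2),
            sq_nonneg (‖D.v s x‖ ^ 2 * ‖L.f t x‖ ^ 2)]
  · rw [integral_const_mul]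
    refine mul_le_mul_of_nonneg_left ?_ (sq_nonneg _)
    rw [integral_add (integrable_const _) hi]
    simpa using hle

lemma memLp_w_mul_factorPart (i : Fin N) (s r t : Fin T) (j : Fin kw) :
    MemLp (fun x => D.w s r x j * L.factorPart i t x) 2 D.P ∧
      ∫ x, (D.w s r x j * L.factorPart i t x) ^ 2 ∂D.P ≤ ‖L.ld i‖ ^ 2 * (1 + C) := by
  obtain ⟨hi, hle⟩ := h.moment_wf s r t
  obtain ⟨hw, hwle⟩ := h.moment_w s r
  have hi' : Integrable (fun x => (1 : ℝ) + (‖D.w s r x‖ ^ 4 + ‖D.w s r x‖ ^ 4 * ‖L.f t x‖ ^ 8) / 2)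
      D.P := (integrable_const (1 : ℝ)).add ((hw.add hi).div_const 2)
  refine memLp_two_of_sq_le
    (((h.stronglyMeasurable_w s r j).mono D.F_le).aestronglyMeasurable.mul
      (L.aestronglyMeasurable_factorPart i t)) (hi'.const_mul (‖L.ld i‖ ^ 2)) (fun x => ?_) ?_
  · rw [mul_pow]
    have h1 := sq_coord_le (D.w s r x) j
    have h2 := L.sq_factorPart_le i t x
    set y := ‖D.w s r x‖
    set z := ‖L.f t x‖
    calc D.w s r x j ^ 2 * L.factorPart i t x ^ 2
        ≤ y ^ 2 * (‖L.ld i‖ ^ 2 * z ^ 2) := mul_le_mul h1 h2 (sq_nonneg _) (sq_nonneg _)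
      _ = ‖L.ld i‖ ^ 2 * (y ^ 2 * z ^ 2) := by ring
      _ ≤ ‖L.ld i‖ ^ 2 * (1 + (y ^ 4 + y ^ 4 * z ^ 8) / 2) := by
          refine mul_le_mul_of_nonneg_left ?_ (sq_nonneg _)
          nlinarith [mul_nonneg (sq_nonneg y) (sq_nonneg (z ^ 2 - 1)), sq_nonneg (y ^ 2 - 1),
            sq_nonneg (y ^ 2 * z ^ 4 - 1)]
  · rw [integral_const_mul]
    refine mul_le_mul_of_nonneg_left ?_ (sq_nonneg _)
    have hwi : Integrable (fun x => (‖D.w s r x‖ ^ 4 + ‖D.w s r x‖ ^ 4 * ‖L.f t x‖ ^ 8) / 2) D.P :=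
      (hw.add hi).div_const 2
    rw [integral_add (integrable_const _) hwi, integral_div,
      integral_add hw hi]
    simp only [integral_const, probReal_univ, smul_eq_mul, one_mul]
    linarith

lemma memLp_w_mul_factorPart_mul_factorPart (i : Fin N) (s r t t' : Fin T) (j : Fin kw) :
    MemLp (fun x => D.w s r x j * (L.factorPart i t x * L.factorPart i t' x)) 2 D.P ∧
      ∫ x, (D.w s r x j * (L.factorPart i t x * L.factorPart i t' x)) ^ 2 ∂D.P
        ≤ (‖L.ld i‖ ^ 2) ^ 2 * (1 + C) := by
  obtain ⟨hi, hle⟩ := h.moment_wf s r t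
  obtain ⟨hi₂, hle₂⟩ := h.moment_wf s r t'
  have hi' : Integrable (fun x => (1 : ℝ) + (‖D.w s r x‖ ^ 4 * ‖L.f t x‖ ^ 8
      + ‖D.w s r x‖ ^ 4 * ‖L.f t' x‖ ^ 8) / 2) D.P :=
    (integrable_const (1 : ℝ)).add ((hi.add hi₂).div_const 2)
  refine memLp_two_of_sq_le
    (((h.stronglyMeasurable_w s r j).mono D.F_le).aestronglyMeasurable.mul
      ((L.aestronglyMeasurable_factorPart i t).mul (L.aestronglyMeasurable_factorPart i t')))
    (hi'.const_mul ((‖L.ld i‖ ^ 2) ^ 2)) (fun x => ?_) ?_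
  · rw [mul_pow, mul_pow]
    have h1 := sq_coord_le (D.w s r x) j
    have h2 := L.sq_factorPart_le i t x
    have h3 := L.sq_factorPart_le i t' x
    set y := ‖D.w s r x‖
    set z := ‖L.f t x‖
    set z' := ‖L.f t' x‖
    calc D.w s r x j ^ 2 * (L.factorPart i t x ^ 2 * L.factorPart i t' x ^ 2)
        ≤ y ^ 2 * ((‖L.ld i‖ ^ 2 * z ^ 2) * (‖L.ld i‖ ^ 2 * z' ^ 2)) :=
          mul_le_mul h1 (mul_le_mul h2 h3 (sq_nonneg _) (by positivity)) (by positivity)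
            (sq_nonneg _)
      _ = (‖L.ld i‖ ^ 2) ^ 2 * (y ^ 2 * (z ^ 2 * z' ^ 2)) := by ring
      _ ≤ (‖L.ld i‖ ^ 2) ^ 2 * (1 + (y ^ 4 * z ^ 8 + y ^ 4 * z' ^ 8) / 2) := by
          refine mul_le_mul_of_nonneg_left ?_ (sq_nonneg _)
          nlinarith [mul_nonneg (sq_nonneg y) (sq_nonneg (z ^ 2 - z' ^ 2)),
            sq_nonneg (y ^ 2 * z ^ 4 - 1), sq_nonneg (y ^ 2 * z' ^ 4 - 1),
            sq_nonneg (y ^ 2 * z ^ 4), sq_nonneg (y ^ 2 * z' ^ 4)]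
  · rw [integral_const_mul]
    refine mul_le_mul_of_nonneg_left ?_ (sq_nonneg _)
    have hii : Integrable (fun x => (‖D.w s r x‖ ^ 4 * ‖L.f t x‖ ^ 8
        + ‖D.w s r x‖ ^ 4 * ‖L.f t' x‖ ^ 8) / 2) D.P := (hi.add hi₂).div_const 2
    rw [integral_add (integrable_const _) hii, integral_div,
      integral_add hi hi₂]
    simp only [integral_const, probReal_univ, smul_eq_mul, one_mul]
    linarith

lemma memLp_w_mul_factorPart_mul_η (i : Fin N) (s r t t' : Fin T) (j : Fin kw) :
    MemLp (fun x => D.w s r x j * (L.factorPart i t x * L.η i t' x)) 2 D.P ∧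
      ∫ x, (D.w s r x j * (L.factorPart i t x * L.η i t' x)) ^ 2 ∂D.P
        ≤ C * ‖L.ld i‖ ^ 2 * (1 + C) := by
  obtain ⟨hm, hle⟩ := h.memLp_w_mul_factorPart i s r t j
  have hV : StronglyMeasurable[L.common] (fun x => D.w s r x j * L.factorPart i t x) :=
    ((h.stronglyMeasurable_w s r j).mono L.F_le_common).mul
      (L.stronglyMeasurable_factorPart_common i t)
  have hif : IndepFun (fun x => D.w s r x j * L.factorPart i t x) (L.η i t') D.P :=
    (indep_of_indep_of_le_right (h.indep_single i t')
      (hV.measurable.comap_le.trans (L.common_le_except _))).symm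
  have hif2 : IndepFun (fun x => (D.w s r x j * L.factorPart i t x) ^ 2)
      (fun x => L.η i t' x ^ 2) D.P :=
    hif.comp (φ := fun y => y ^ 2) (ψ := fun y => y ^ 2) (by fun_prop) (by fun_prop)
  have hη2 : MemLp (L.η i t') 2 D.P := (h.moment_η i t').1.mono_exponent (by norm_num)
  have e : ∀ x, (D.w s r x j * (L.factorPart i t x * L.η i t' x)) ^ 2
      = (D.w s r x j * L.factorPart i t x) ^ 2 * L.η i t' x ^ 2 := fun x => by ring
  refine memLp_two_of_sq_le
    (((h.stronglyMeasurable_w s r j).mono D.F_le).aestronglyMeasurable.mul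
      ((L.aestronglyMeasurable_factorPart i t).mul hη2.1))
    (hif2.integrable_mul hm.integrable_sq hη2.integrable_sq) (fun x => (e x).le) ?_
  have := hif2.integral_fun_mul_eq_mul_integral (hm.1.pow 2) (hη2.1.pow 2)
  simp only [Pi.mul_apply]
  rw [this, h.second_η i t']
  calc (∫ x, (D.w s r x j * L.factorPart i t x) ^ 2 ∂D.P) * L.σ i ^ 2
      ≤ (‖L.ld i‖ ^ 2 * (1 + C)) * C :=
        mul_le_mul hle (h.variance_le i) (sq_nonneg _)
          (mul_nonneg (sq_nonneg _) (by linarith [h.one_le]))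
    _ = C * ‖L.ld i‖ ^ 2 * (1 + C) := by ring

/-- The part of `ξ i` that involves the factors is small in mean square, on average over the units:
its second moment is at most a multiple of `‖π i‖²`, whose sum over the units is bounded. -/
lemma score_factor_moment (i : Fin N) (a : (Fin kγ × Fin kv) ⊕ Fin kw) :
    MemLp (fun x => D.score i (fun t x => L.factorPart i t x + L.η i t x) x a
        - D.score i (L.η i) x a) 2 D.P ∧
      ∫ x, (D.score i (fun t x => L.factorPart i t x + L.η i t x) x a
        - D.score i (L.η i) x a) ^ 2 ∂D.P ≤ 18 * C ^ 3 * ‖L.ld i‖ ^ 2 := by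
  have hC := h.one_le
  have hC0 : 0 ≤ C := by linarith
  have hπ0 : 0 ≤ ‖L.ld i‖ ^ 2 := sq_nonneg _
  rcases a with ⟨p, q⟩ | j
  · have e : ∀ x, D.score i (fun t x => L.factorPart i t x + L.η i t x) x (Sum.inl (p, q))
        - D.score i (L.η i) x (Sum.inl (p, q))
        = ((1 / √(T : ℝ)) * D.γ i p) * ∑ s, D.v s x q * L.factorPart i s x := fun x => by
      simp only [Panel.score, Sum.elim_inl, ← mul_sub, ← Finset.sum_sub_distrib]
      rw [mul_assoc, Finset.mul_sum (a := D.γ i p)]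
      congr 1
      exact Finset.sum_congr rfl fun s _ => by ring
    simp_rw [e, mul_pow]
    have hm := fun s => h.memLp_v_mul_factorPart i s s q
    refine ⟨(memLp_finsetSum _ fun s _ => (hm s).1).const_mul _, ?_⟩
    rw [integral_const_mul, integral_sq_linear_form L.exceptTime_le L.F_le_exceptTime
      (fun s => h.stronglyMeasurable_v s q) (h.integrable_factorPart i)
      (fun r s hrs => L.stronglyMeasurable_factorPart_exceptTime i hrs)
      (h.condExp_factorPart i) (fun s => (hm s).1), one_div_sqrt_sq]
    have hs : ∑ s, ∫ x, (D.v s x q * L.factorPart i s x) ^ 2 ∂D.P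
        ≤ T * (‖L.ld i‖ ^ 2 * (1 + C)) := by
      simpa using Finset.sum_le_card_nsmul Finset.univ _ _ fun s _ => (hm s).2
    have hT := one_div_pow_mul_pow_le_one T 1
    rw [pow_one, pow_one] at hT
    calc 1 / (T : ℝ) * D.γ i p ^ 2 * ∑ s, ∫ x, (D.v s x q * L.factorPart i s x) ^ 2 ∂D.P
        ≤ 1 / (T : ℝ) * C ^ 2 * (T * (‖L.ld i‖ ^ 2 * (1 + C))) :=
          mul_le_mul (mul_le_mul_of_nonneg_left (h.weight_sq_le i p) (by positivity)) hs
            (Finset.sum_nonneg fun s _ => integral_nonneg fun x => sq_nonneg _) (by positivity)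
      _ = (1 / (T : ℝ) * T) * (C ^ 2 * (1 + C) * ‖L.ld i‖ ^ 2) := by ring
      _ ≤ 1 * (C ^ 2 * (1 + C) * ‖L.ld i‖ ^ 2) :=
          mul_le_mul_of_nonneg_right hT (by positivity)
      _ ≤ 18 * C ^ 3 * ‖L.ld i‖ ^ 2 := by
          rw [one_mul]
          refine mul_le_mul_of_nonneg_right ?_ hπ0
          nlinarith [pow_nonneg hC0 2]
  · -- the three bilinear forms other than the one in the remainders alone
    set S₁ : D.Ω → ℝ := fun x => ∑ s, ∑ t ∈ Finset.Iio s,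
      D.w s t x j * (L.factorPart i t x * L.factorPart i s x) with hS₁
    set S₂ : D.Ω → ℝ := fun x => ∑ s, ∑ t ∈ Finset.Iio s,
      D.w s t x j * (L.factorPart i t x * L.η i s x) with hS₂
    set S₃ : D.Ω → ℝ := fun x => ∑ s, ∑ t ∈ Finset.Iio s,
      D.w s t x j * (L.η i t x * L.factorPart i s x) with hS₃
    have e : ∀ x, D.score i (fun t x => L.factorPart i t x + L.η i t x) x (Sum.inr j)
        - D.score i (L.η i) x (Sum.inr j) = (1 / (T : ℝ)) * (S₁ x + S₂ x + S₃ x) := fun x => by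
      simp only [Panel.score, Sum.elim_inr, ← mul_sub, ← Finset.sum_sub_distrib, hS₁, hS₂, hS₃,
        ← Finset.sum_add_distrib]
      congr 1
      exact Finset.sum_congr rfl fun s _ => Finset.sum_congr rfl fun t _ => by ring
    have bound : ∀ (X Y : Fin T → D.Ω → ℝ) (B : ℝ), 0 ≤ B →
        (∀ s, Integrable (X s) D.P) → (∀ s, Integrable (Y s) D.P) →
        (∀ r s, r ≠ s → StronglyMeasurable[L.exceptTime s] (X r)) →
        (∀ r s, r ≠ s → StronglyMeasurable[L.exceptTime s] (Y r)) →
        (∀ s, D.P[X s | L.exceptTime s] =ᵐ[D.P] 0) → (∀ s, D.P[Y s | L.exceptTime s] =ᵐ[D.P] 0) →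
        (∀ s t, MemLp (fun x => D.w s t x j * (X t x * Y s x)) 2 D.P ∧
          ∫ x, (D.w s t x j * (X t x * Y s x)) ^ 2 ∂D.P ≤ B) →
        MemLp (fun x => ∑ s, ∑ t ∈ Finset.Iio s, D.w s t x j * (X t x * Y s x)) 2 D.P ∧
        ∫ x, (∑ s, ∑ t ∈ Finset.Iio s, D.w s t x j * (X t x * Y s x)) ^ 2 ∂D.P
          ≤ (T : ℝ) ^ 2 * B := by
      intro X Y B hB hX hY hXK hYK hX0 hY0 h2
      refine ⟨memLp_finsetSum _ fun s _ => memLp_finsetSum _ fun t _ => (h2 s t).1, ?_⟩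
      rw [integral_sq_bilinear_form L.exceptTime_le L.F_le_exceptTime
        (fun s t => h.stronglyMeasurable_w s t j) hX hY hXK hYK hX0 hY0 (fun s t _ => (h2 s t).1)]
      have h1 : ∀ s, ∑ t ∈ Finset.Iio s, ∫ x, (D.w s t x j * (X t x * Y s x)) ^ 2 ∂D.P
          ≤ T * B := fun s => by
        have := Finset.sum_le_card_nsmul (Finset.Iio s)
          (fun t => ∫ x, (D.w s t x j * (X t x * Y s x)) ^ 2 ∂D.P) B fun t _ => (h2 s t).2
        rw [nsmul_eq_mul] at this
        exact this.trans (mul_le_mul_of_nonneg_right (card_Iio_le s) hB)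
      have := Finset.sum_le_card_nsmul Finset.univ _ (T * B) fun s _ => h1 s
      rw [nsmul_eq_mul, Finset.card_univ, Fintype.card_fin] at this
      calc _ ≤ _ := this
        _ = (T : ℝ) ^ 2 * B := by ring
    have hηi : ∀ s, Integrable (L.η i s) D.P := fun s =>
      (h.moment_η i s).1.integrable (by norm_num)
    have hηK : ∀ r s, r ≠ s → StronglyMeasurable[L.exceptTime s] (L.η i r) := fun r s hrs =>
      L.stronglyMeasurable_η_exceptTime hrs
    have haK : ∀ r s, r ≠ s → StronglyMeasurable[L.exceptTime s] (L.factorPart i r) :=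
      fun r s hrs => L.stronglyMeasurable_factorPart_exceptTime i hrs
    obtain ⟨m₁, b₁⟩ := bound (L.factorPart i) (L.factorPart i) _
      (by positivity) (h.integrable_factorPart i) (h.integrable_factorPart i) haK haK
      (h.condExp_factorPart i) (h.condExp_factorPart i)
      (fun s t => h.memLp_w_mul_factorPart_mul_factorPart i s t t s j)
    obtain ⟨m₂, b₂⟩ := bound (L.factorPart i) (L.η i) _
      (by positivity) (h.integrable_factorPart i) hηi haK hηK
      (h.condExp_factorPart i) (h.condExp_η i)
      (fun s t => h.memLp_w_mul_factorPart_mul_η i s t t s j)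
    obtain ⟨m₃, b₃⟩ := bound (L.η i) (L.factorPart i) (C * ‖L.ld i‖ ^ 2 * (1 + C))
      (by positivity) hηi (h.integrable_factorPart i) hηK haK
      (h.condExp_η i) (h.condExp_factorPart i)
      (fun s t => by
        simpa only [mul_comm (L.η i t _)] using h.memLp_w_mul_factorPart_mul_η i s t s t j)
    have hsum : MemLp (fun x => S₁ x + S₂ x + S₃ x) 2 D.P := (m₁.add m₂).add m₃
    simp_rw [e, mul_pow]
    refine ⟨hsum.const_mul _, ?_⟩
    rw [integral_const_mul]
    have i12 : Integrable (fun x => S₁ x ^ 2 + S₂ x ^ 2) D.P :=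
      m₁.integrable_sq.add m₂.integrable_sq
    have i123 : Integrable (fun x => S₁ x ^ 2 + S₂ x ^ 2 + S₃ x ^ 2) D.P :=
      i12.add m₃.integrable_sq
    have hle : ∫ x, (S₁ x + S₂ x + S₃ x) ^ 2 ∂D.P
        ≤ (T : ℝ) ^ 2 * (18 * C ^ 2 * ‖L.ld i‖ ^ 2) := by
      have h1 : ∫ x, (S₁ x + S₂ x + S₃ x) ^ 2 ∂D.P
          ≤ ∫ x, 3 * (S₁ x ^ 2 + S₂ x ^ 2 + S₃ x ^ 2) ∂D.P := by
        refine integral_mono hsum.integrable_sq (i123.const_mul 3) fun x => ?_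
        simp only
        nlinarith [sq_nonneg (S₁ x - S₂ x), sq_nonneg (S₁ x - S₃ x), sq_nonneg (S₂ x - S₃ x)]
      rw [integral_const_mul, integral_add i12 m₃.integrable_sq,
        integral_add m₁.integrable_sq m₂.integrable_sq] at h1
      have hπ := h.loading_sq_le i
      have h4 : (‖L.ld i‖ ^ 2) ^ 2 * (1 + C) ≤ C * ‖L.ld i‖ ^ 2 * (1 + C) := by
        rw [sq (‖L.ld i‖ ^ 2)]
        exact mul_le_mul_of_nonneg_right (mul_le_mul_of_nonneg_right hπ hπ0) (by linarith)
      have h5 : C * ‖L.ld i‖ ^ 2 * (1 + C) ≤ 2 * C ^ 2 * ‖L.ld i‖ ^ 2 := by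
        have : C * (1 + C) ≤ 2 * C ^ 2 := by nlinarith
        nlinarith
      have hT2 : (0 : ℝ) ≤ (T : ℝ) ^ 2 := by positivity
      have h6 := mul_le_mul_of_nonneg_left (h4.trans h5) hT2
      have h7 := mul_le_mul_of_nonneg_left h5 hT2
      linarith
    calc (1 / (T : ℝ)) ^ 2 * ∫ x, (S₁ x + S₂ x + S₃ x) ^ 2 ∂D.P
        ≤ (1 / (T : ℝ)) ^ 2 * ((T : ℝ) ^ 2 * (18 * C ^ 2 * ‖L.ld i‖ ^ 2)) :=
          mul_le_mul_of_nonneg_left hle (by positivity)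
      _ = ((1 / (T : ℝ)) ^ 2 * (T : ℝ) ^ 2) * (18 * C ^ 2 * ‖L.ld i‖ ^ 2) := by ring
      _ ≤ 1 * (18 * C ^ 2 * ‖L.ld i‖ ^ 2) :=
          mul_le_mul_of_nonneg_right (one_div_pow_mul_pow_le_one T 2) (by positivity)
      _ ≤ 18 * C ^ 3 * ‖L.ld i‖ ^ 2 := by
          rw [one_mul]
          refine mul_le_mul_of_nonneg_right ?_ hπ0
          have := pow_le_pow_right₀ hC (show 2 ≤ 3 by norm_num)
          linarith

end Panel.Regular

end Units

/-! ### The average conditional second moment -/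

section Centre

variable {N T kv kw kγ kf : ℕ}

/-- The conditional second moment, given the common shocks, of the part of `ξ i` that comes from
the remainders. -/
noncomputable def Latent.centre {D : Panel N T kv kw kγ} (L : Latent D kf) (i : Fin N) (x : D.Ω) :
    Matrix ((Fin kγ × Fin kv) ⊕ Fin kw) ((Fin kγ × Fin kv) ⊕ Fin kw) ℝ :=
  Matrix.fromBlocks ((L.σ i ^ 2 • outer (D.γ i)) ⊗ₖ D.avgV x) 0 0 (L.σ i ^ 4 • D.avgW x)

lemma Panel.avgV_apply (D : Panel N T kv kw kγ) (x : D.Ω) (p q : Fin kv) :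
    D.avgV x p q = (1 / (T : ℝ)) * ∑ s, D.v s x p * D.v s x q := by
  simp [Panel.avgV, outer, Matrix.sum_apply]

lemma Panel.avgW_apply (D : Panel N T kv kw kγ) (x : D.Ω) (p q : Fin kw) :
    D.avgW x p q = (1 / (T : ℝ) ^ 2) * ∑ s, ∑ t ∈ Finset.Iio s, D.w s t x p * D.w s t x q := by
  simp [Panel.avgW, outer, Matrix.sum_apply]

lemma Panel.covEst_apply (D : Panel N T kv kw kγ) (x : D.Ω) (a b : (Fin kγ × Fin kv) ⊕ Fin kw) :
    D.covEst x a b = (1 / (N : ℝ)) * ∑ i, D.ξ i x a * D.ξ i x b := by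
  simp [Panel.covEst, Matrix.sum_apply, Matrix.vecMulVec_apply]

namespace Panel.Regular

variable {D : Panel N T kv kw kγ} {L : Latent D kf} {C : ℝ} (h : D.Regular L C)

include h

lemma avgV_regular (p q : Fin kv) : StronglyMeasurable[D.F] (fun x => D.avgV x p q) ∧
    MemLp (fun x => D.avgV x p q) 2 D.P := by
  simp_rw [D.avgV_apply]
  exact ⟨(Finset.stronglyMeasurable_fun_sum _ fun s _ =>
      (h.stronglyMeasurable_v s p).mul (h.stronglyMeasurable_v s q)).const_mul _,
    (memLp_finsetSum _ fun s _ => (h.memLp_v s p).1.mul_four (h.memLp_v s q).1).const_mul _⟩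

lemma avgW_regular (p q : Fin kw) : StronglyMeasurable[D.F] (fun x => D.avgW x p q) ∧
    MemLp (fun x => D.avgW x p q) 2 D.P := by
  simp_rw [D.avgW_apply]
  exact ⟨(Finset.stronglyMeasurable_fun_sum _ fun s _ => Finset.stronglyMeasurable_fun_sum _
      fun t _ => (h.stronglyMeasurable_w s t p).mul (h.stronglyMeasurable_w s t q)).const_mul _,
    (memLp_finsetSum _ fun s _ => memLp_finsetSum _ fun t _ =>
      (h.memLp_w s t p).1.mul_four (h.memLp_w s t q).1).const_mul _⟩

lemma centre_regular (i : Fin N) (a b : (Fin kγ × Fin kv) ⊕ Fin kw) :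
    StronglyMeasurable[D.F] (fun x => L.centre i x a b) ∧
      MemLp (fun x => L.centre i x a b) 2 D.P := by
  rcases a with ⟨p, q⟩ | j <;> rcases b with ⟨p', q'⟩ | j'
  · have := h.avgV_regular q q'
    simp only [Latent.centre, Matrix.fromBlocks_apply₁₁, Matrix.kroneckerMap_apply]
    exact ⟨this.1.const_mul _, this.2.const_mul _⟩
  · simpa [Latent.centre] using stronglyMeasurable_const
  · simpa [Latent.centre] using stronglyMeasurable_const
  · have := h.avgW_regular j j'
    simp only [Latent.centre, Matrix.fromBlocks_apply₂₂, Matrix.smul_apply, smul_eq_mul]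
    exact ⟨this.1.const_mul _, this.2.const_mul _⟩

lemma integral_monomials (i : Fin N) (A B : Finset (Fin T)) :
    ∫ x, (∏ s ∈ A, L.η i s x) * (∏ s ∈ B, L.η i s x) ∂D.P
      = if A = B then (L.σ i ^ 2) ^ A.card else 0 :=
  integral_prod_mul_prod (h.indep_η.precomp (g := fun t => (i, t))
      fun _ _ hst => (Prod.mk.inj hst).2)
    (fun s => (L.measurable_η i s).aemeasurable) (h.mean_η i) (h.second_η i) A B

lemma memLp_η_mul_η (i : Fin N) {s t : Fin T} (hst : t ≠ s) :
    MemLp (fun x => L.η i t x * L.η i s x) 4 D.P :=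
  (h.indep_η.indepFun (i := (i, t)) (j := (i, s)) (by simpa using hst)).memLp_four_mul
    (h.moment_η i t).1 (h.moment_η i s).1

/-- `L.centre i` is the conditional expectation of the outer square of the remainder part of `ξ i`,
given the common shocks, the factors and the remainders of the other units. -/
lemma integral_mul_sub_centre (i : Fin N) (a b : (Fin kγ × Fin kv) ⊕ Fin kw) {Z : D.Ω → ℝ}
    (hZm : StronglyMeasurable[L.except {p | p.1 = i}] Z) (hZ : MemLp Z 2 D.P) :
    ∫ x, Z x * (D.score i (L.η i) x a * D.score i (L.η i) x b - L.centre i x a b) ∂D.P = 0 := by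
  set Q : Finset ((_ : Fin T) × Fin T) := Finset.univ.sigma fun s => Finset.Iio s with hQ
  have hlt : ∀ p ∈ Q, p.2 < p.1 := fun p hp => by simpa [hQ] using hp
  -- linear and quadratic parts as combinations of square-free monomials
  have eV : ∀ x p q, D.score i (L.η i) x (Sum.inl (p, q))
      = ∑ s, ((1 / √(T : ℝ)) * D.γ i p * D.v s x q) * L.η i s x := fun x p q => by
    simp only [Panel.score, Sum.elim_inl, Finset.mul_sum]
    exact Finset.sum_congr rfl fun s _ => by ring
  have eW : ∀ x j, D.score i (L.η i) x (Sum.inr j)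
      = ∑ p ∈ Q, ((1 / (T : ℝ)) * D.w p.1 p.2 x j) * (L.η i p.2 x * L.η i p.1 x) := fun x j => by
    simp only [Panel.score, Sum.elim_inr, hQ, Finset.sum_sigma, Finset.mul_sum]
    exact Finset.sum_congr rfl fun s _ => Finset.sum_congr rfl fun t _ => by ring
  have hvH : ∀ p q, ∀ s ∈ Finset.univ, StronglyMeasurable[L.except {p | p.1 = i}]
      (fun x => (1 / √(T : ℝ)) * D.γ i p * D.v s x q) := fun p q s _ =>
    ((h.stronglyMeasurable_v s q).mono (L.F_le_except _)).const_mul _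
  have hv4 : ∀ p q, ∀ s ∈ Finset.univ,
      MemLp (fun x => (1 / √(T : ℝ)) * D.γ i p * D.v s x q) 4 D.P := fun p q s _ =>
    (h.memLp_v s q).1.const_mul _
  have hwH : ∀ j, ∀ p ∈ Q, StronglyMeasurable[L.except {p | p.1 = i}]
      (fun x => (1 / (T : ℝ)) * D.w p.1 p.2 x j) := fun j p _ =>
    ((h.stronglyMeasurable_w p.1 p.2 j).mono (L.F_le_except _)).const_mul _
  have hw4 : ∀ j, ∀ p ∈ Q, MemLp (fun x => (1 / (T : ℝ)) * D.w p.1 p.2 x j) 4 D.P := fun j p _ =>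
    (h.memLp_w p.1 p.2 j).1.const_mul _
  have hηm : ∀ s, StronglyMeasurable[L.remainders {p | p.1 = i}] (L.η i s) := fun s =>
    L.stronglyMeasurable_η (S := {p | p.1 = i}) rfl
  have hMm : ∀ p ∈ Q, StronglyMeasurable[L.remainders {p | p.1 = i}]
      (fun x => L.η i p.2 x * L.η i p.1 x) := fun p _ => (hηm p.2).mul (hηm p.1)
  have hM4 : ∀ p ∈ Q, MemLp (fun x => L.η i p.2 x * L.η i p.1 x) 4 D.P := fun p hp =>
    h.memLp_η_mul_η i (hlt p hp).ne
  have hVV : ∀ s ∈ Finset.univ, ∀ t ∈ Finset.univ, ∫ x, L.η i s x * L.η i t x ∂D.P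
      = if s = t then L.σ i ^ 2 else 0 := fun s _ t _ => by
    simpa using h.integral_monomials i {s} {t}
  have hVW : ∀ s ∈ Finset.univ, ∀ p ∈ Q,
      ∫ x, L.η i s x * (L.η i p.2 x * L.η i p.1 x) ∂D.P = 0 := fun s _ p hp => by
    have hne : ({s} : Finset (Fin T)) ≠ {p.2, p.1} := fun h' => by
      have := congrArg Finset.card h'
      rw [Finset.card_pair (hlt p hp).ne] at this
      simp at this
    have := h.integral_monomials i {s} {p.2, p.1}
    simpa [hne, Finset.prod_pair (hlt p hp).ne] using this
  have hWW : ∀ p ∈ Q, ∀ q ∈ Q,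
      ∫ x, L.η i p.2 x * L.η i p.1 x * (L.η i q.2 x * L.η i q.1 x) ∂D.P
        = if p = q then L.σ i ^ 4 else 0 := fun p hp q hq => by
    have := h.integral_monomials i {p.2, p.1} {q.2, q.1}
    simp only [Finset.prod_pair (hlt p hp).ne, Finset.prod_pair (hlt q hq).ne,
      Finset.card_pair (hlt p hp).ne] at this
    rw [this]
    by_cases hpq : p = q
    · subst hpq
      simp only [if_true]
      ring
    · rw [if_neg hpq, if_neg]
      intro hset
      apply hpq
      have hp' := hlt p hp
      have hq' := hlt q hq
      obtain ⟨s, t⟩ := p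
      obtain ⟨s', t'⟩ := q
      simp only at hp' hq' hset
      have h1 : s ∈ ({t', s'} : Finset (Fin T)) := hset ▸ (by simp)
      have h2 : t ∈ ({t', s'} : Finset (Fin T)) := hset ▸ (by simp)
      have h3 : s' ∈ ({t, s} : Finset (Fin T)) := hset ▸ (by simp)
      simp only [Finset.mem_insert, Finset.mem_singleton] at h1 h2 h3
      have hs : s = s' := by
        rcases h1 with h1 | h1
        · rcases h3 with h3 | h3
          · subst h1; subst h3; exact absurd hp' (lt_asymm hq')
          · exact h3.symm
        · exact h1
      have ht : t = t' := by
        rcases h2 with h2 | h2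
        · exact h2
        · subst hs; subst h2; exact absurd hp' (lt_irrefl _)
      subst hs; subst ht; rfl
  have hsT : (1 / √(T : ℝ)) * (1 / √(T : ℝ)) = 1 / T := by
    rw [← sq, one_div_sqrt_sq]
  have key := @integral_mul_combination_eq_zero D.Ω (L.except {p | p.1 = i})
    (L.remainders {p | p.1 = i}) D.mΩ D.P _
  have hind := h.indep_remainders {p | p.1 = i}
  rcases a with ⟨p, q⟩ | j <;> rcases b with ⟨p', q'⟩ | j'
  · rw [← key Finset.univ Finset.univ (L.except_le _) (L.remainders_le _) hind (hvH p q)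
      (hvH p' q') (hv4 p q) (hv4 p' q') (fun s _ => hηm s) (fun s _ => hηm s)
      (fun s _ => (h.moment_η i s).1) (fun s _ => (h.moment_η i s).1) hVV hZm hZ]
    refine integral_congr_ae (Eventually.of_forall fun x => ?_)
    simp only [eV, Latent.centre, Matrix.fromBlocks_apply₁₁, Matrix.kroneckerMap_apply,
      D.avgV_apply, Matrix.smul_apply, outer, Matrix.of_apply, smul_eq_mul, mul_ite, mul_zero,
      Finset.sum_ite_eq, Finset.mem_univ, if_true]
    congr 2
    simp only [Finset.mul_sum]
    refine Finset.sum_congr rfl fun s _ => ?_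
    rw [← hsT]
    ring
  · rw [← key Finset.univ Q (L.except_le _) (L.remainders_le _) hind (hvH p q)
      (hwH j') (hv4 p q) (hw4 j') (fun s _ => hηm s) hMm
      (fun s _ => (h.moment_η i s).1) hM4 hVW hZm hZ]
    refine integral_congr_ae (Eventually.of_forall fun x => ?_)
    simp [eV, eW, Latent.centre]
  · rw [← key Finset.univ Q (L.except_le _) (L.remainders_le _) hind (hvH p' q')
      (hwH j) (hv4 p' q') (hw4 j) (fun s _ => hηm s) hMm
      (fun s _ => (h.moment_η i s).1) hM4 hVW hZm hZ]
    refine integral_congr_ae (Eventually.of_forall fun x => ?_)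
    simp [eV, eW, Latent.centre, mul_comm]
  · rw [← key Q Q (L.except_le _) (L.remainders_le _) hind (hwH j)
      (hwH j') (hw4 j) (hw4 j') hMm hMm hM4 hM4 hWW hZm hZ]
    refine integral_congr_ae (Eventually.of_forall fun x => ?_)
    simp only [eW, Latent.centre, Matrix.fromBlocks_apply₂₂, D.avgW_apply, Matrix.smul_apply,
      smul_eq_mul, mul_ite, mul_zero]
    congr 2
    rw [hQ, Finset.sum_sigma', Finset.mul_sum, Finset.mul_sum]
    refine Finset.sum_congr rfl fun r hr => ?_
    rw [Finset.sum_ite_eq, if_pos hr]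
    ring

lemma stronglyMeasurable_score (i j : Fin N) (hji : j ≠ i) (a : (Fin kγ × Fin kv) ⊕ Fin kw) :
    StronglyMeasurable[L.except {p | p.1 = i}] (fun x => D.score j (L.η j) x a) := by
  have hη : ∀ s, StronglyMeasurable[L.except {p | p.1 = i}] (L.η j s) := fun s =>
    L.stronglyMeasurable_η_except hji
  rcases a with ⟨p, q⟩ | k
  · simp only [Panel.score, Sum.elim_inl]
    exact (Finset.stronglyMeasurable_fun_sum _ fun s _ =>
      (((h.stronglyMeasurable_v s q).mono (L.F_le_except _)).const_mul _).mul (hη s)).const_mul _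
  · simp only [Panel.score, Sum.elim_inr]
    exact (Finset.stronglyMeasurable_fun_sum _ fun s _ => Finset.stronglyMeasurable_fun_sum _
      fun t _ => ((h.stronglyMeasurable_w s t k).mono (L.F_le_except _)).mul
        ((hη t).mul (hη s))).const_mul _

/-- Law of large numbers across units for the remainder parts. -/
lemma integral_sq_sub_centre_le (a b : (Fin kγ × Fin kv) ⊕ Fin kw) :
    ∫ x, ((1 / (N : ℝ)) * ∑ i, (D.score i (L.η i) x a * D.score i (L.η i) x b
      - L.centre i x a b)) ^ 2 ∂D.P ≤ 256 * C ^ 7 / N :=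
  integral_sq_average_le (H := fun i => L.except {p | p.1 = i})
    (fun i => (h.score_remainder_moment i a).1) (fun i => (h.score_remainder_moment i b).1)
    (fun i => (h.centre_regular i a b).2)
    (fun i => (h.centre_regular i a b).1.mono (L.F_le_except _))
    (fun i j hji => ((h.stronglyMeasurable_score i j hji a).mul
      (h.stronglyMeasurable_score i j hji b)).sub
        ((h.centre_regular j a b).1.mono (L.F_le_except _)))
    (fun i _ hZm hZ => h.integral_mul_sub_centre i a b hZm hZ)
    (fun i => (h.score_remainder_moment i a).2) (fun i => (h.score_remainder_moment i b).2)

lemma ξ_ae_eq (i : Fin N) : ∀ᵐ x ∂D.P,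
    D.ξ i x = D.score i (fun t x => L.factorPart i t x + L.η i t x) x := by
  filter_upwards [ae_all_iff.2 (h.decomposition i)] with x hx
  have : ∀ t, D.e i t x = L.factorPart i t x + L.η i t x := hx
  funext a
  rcases a with p | j <;> simp [Panel.ξ, Panel.score, this]

/-- The estimator is within `O(N^{-1/2})` in mean of the average conditional second moment. -/
lemma integral_abs_covEst_sub_le (hN : 0 < N) (a b : (Fin kγ × Fin kv) ⊕ Fin kw) :
    Integrable (fun x => D.covEst x a b - (1 / (N : ℝ)) * ∑ i, L.centre i x a b) D.P ∧
    ∫ x, |D.covEst x a b - (1 / (N : ℝ)) * ∑ i, L.centre i x a b| ∂D.P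
      ≤ (2 + 1000 * C ^ 7) / √(N : ℝ) := by
  have hC := h.one_le
  have hC0 : 0 ≤ C := by linarith
  have hNr : (0 : ℝ) < N := by exact_mod_cast hN
  set n := √(N : ℝ) with hn
  have hn0 : 0 < n := Real.sqrt_pos.2 hNr
  have hnn : n * n = N := Real.mul_self_sqrt hNr.le
  have hn1 : 1 ≤ n := Real.one_le_sqrt.2 (by exact_mod_cast hN)
  set X : Fin N → (Fin kγ × Fin kv) ⊕ Fin kw → D.Ω → ℝ :=
    fun i a x => D.score i (L.η i) x a with hX
  set r : Fin N → (Fin kγ × Fin kv) ⊕ Fin kw → D.Ω → ℝ := fun i a x =>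
    D.score i (fun t x => L.factorPart i t x + L.η i t x) x a - D.score i (L.η i) x a with hr
  have hX4 := fun i a => h.score_remainder_moment i a
  have hX2 : ∀ i a, MemLp (X i a) 2 D.P := fun i a => (hX4 i a).1.mono_exponent (by norm_num)
  have hr2 := fun i a => h.score_factor_moment i a
  have hXB : ∀ i a, ∫ x, X i a x ^ 2 ∂D.P ≤ 1 + 256 * C ^ 7 := fun i a => by
    calc ∫ x, X i a x ^ 2 ∂D.P ≤ ∫ x, (1 + X i a x ^ 4) ∂D.P := by
          refine integral_mono (hX2 i a).integrable_sq
            ((integrable_const _).add (hX4 i a).1.integrable_pow_four) fun x => ?_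
          simp only
          nlinarith [sq_nonneg (X i a x ^ 2 - 1), sq_nonneg (X i a x)]
      _ = 1 + ∫ x, X i a x ^ 4 ∂D.P := by
          rw [integral_add (integrable_const _) (hX4 i a).1.integrable_pow_four]
          simp [hX]
      _ ≤ 1 + 256 * C ^ 7 := by linarith [(hX4 i a).2]
  -- the deviation of the remainder part
  set Y : D.Ω → ℝ := fun x => (1 / (N : ℝ)) * ∑ i, (X i a x * X i b x - L.centre i x a b) with hY
  have hY2 : MemLp Y 2 D.P := (memLp_finsetSum _ fun i _ =>
    ((hX4 i a).1.mul_four (hX4 i b).1).sub (h.centre_regular i a b).2).const_mul _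
  have hYB : ∫ x, Y x ^ 2 ∂D.P ≤ 256 * C ^ 7 / N := h.integral_sq_sub_centre_le a b
  -- the deviation caused by the factors
  set U : D.Ω → ℝ := fun x =>
    (1 / (N : ℝ)) * ∑ i, (r i a x * X i b x + X i a x * r i b x + r i a x * r i b x) with hU
  have hUi : Integrable U D.P := (integrable_finsetSum _ fun i _ =>
    (((hr2 i a).1.integrable_mul (hX2 i b)).add ((hX2 i a).integrable_mul (hr2 i b).1)).add
      ((hr2 i a).1.integrable_mul (hr2 i b).1)).const_mul _
  have hYi : Integrable Y D.P := hY2.integrable (by norm_num)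
  have hdec : ∀ᵐ x ∂D.P, D.covEst x a b - (1 / (N : ℝ)) * ∑ i, L.centre i x a b = U x + Y x := by
    filter_upwards [ae_all_iff.2 h.ξ_ae_eq] with x hx
    rw [D.covEst_apply, hU, hY]
    simp only [hx, hX, hr]
    rw [← mul_sub, ← mul_add, ← Finset.sum_sub_distrib, ← Finset.sum_add_distrib]
    congr 1
    exact Finset.sum_congr rfl fun i _ => by ring
  refine ⟨(hUi.add hYi).congr (hdec.mono fun x hx => hx.symm), ?_⟩
  have hYabs : ∫ x, |Y x| ∂D.P ≤ (1 + 256 * C ^ 7) / n := by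
    have hi : Integrable (fun x => n * Y x ^ 2 + 1 / n) D.P :=
      (hY2.integrable_sq.const_mul n).add (integrable_const _)
    calc ∫ x, |Y x| ∂D.P ≤ ∫ x, (n * Y x ^ 2 + 1 / n) ∂D.P := by
          refine integral_mono hYi.abs hi fun x => ?_
          simp only
          have e : n * Y x ^ 2 + 1 / n - |Y x| = ((n * |Y x| - 1) ^ 2 + n * |Y x|) / n := by
            rw [← sq_abs (Y x)]; field_simp; ring
          have : 0 ≤ ((n * |Y x| - 1) ^ 2 + n * |Y x|) / n := by positivity
          linarith
      _ = n * ∫ x, Y x ^ 2 ∂D.P + 1 / n := by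
          rw [integral_add (hY2.integrable_sq.const_mul n) (integrable_const _),
            integral_const_mul]
          simp
      _ ≤ n * (256 * C ^ 7 / N) + 1 / n := by gcongr
      _ = (1 + 256 * C ^ 7) / n := by rw [← hnn]; field_simp; ring
  have hUabs : ∫ x, |U x| ∂D.P ≤ (1 + 300 * C ^ 7) / n := by
    -- Young's inequality with weight `n = √N` balances `∑ i, E r i² = O(1)` against `E X i² = O(1)`
    set G : Fin N → D.Ω → ℝ := fun i x => n * (r i a x ^ 2 + r i b x ^ 2)
      + (1 / (2 * n)) * (X i a x ^ 2 + X i b x ^ 2) with hG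
    have i1 : ∀ i, Integrable (fun x => n * (r i a x ^ 2 + r i b x ^ 2)) D.P := fun i =>
      ((hr2 i a).1.integrable_sq.add (hr2 i b).1.integrable_sq).const_mul n
    have i2 : ∀ i, Integrable (fun x => (1 / (2 * n)) * (X i a x ^ 2 + X i b x ^ 2)) D.P := fun i =>
      ((hX2 i a).integrable_sq.add (hX2 i b).integrable_sq).const_mul _
    have hGi : ∀ i, Integrable (G i) D.P := fun i => (i1 i).add (i2 i)
    have hGB : ∀ i, ∫ x, G i x ∂D.P
        ≤ n * (36 * C ^ 3 * ‖L.ld i‖ ^ 2) + (1 + 256 * C ^ 7) / n := fun i => by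
      simp only [hG]
      rw [integral_add (i1 i) (i2 i), integral_const_mul, integral_const_mul,
        integral_add (hr2 i a).1.integrable_sq (hr2 i b).1.integrable_sq,
        integral_add (hX2 i a).integrable_sq (hX2 i b).integrable_sq]
      have e : (1 + 256 * C ^ 7) / n
          = (1 / (2 * n)) * ((1 + 256 * C ^ 7) + (1 + 256 * C ^ 7)) := by
        field_simp; ring
      rw [e]
      refine add_le_add (mul_le_mul_of_nonneg_left ?_ hn0.le)
        (mul_le_mul_of_nonneg_left (add_le_add (hXB i a) (hXB i b)) (by positivity))
      linarith [(hr2 i a).2, (hr2 i b).2]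
    have hUG : ∀ x, |U x| ≤ (1 / (N : ℝ)) * ∑ i, G i x := fun x => by
      rw [hU]
      simp only
      rw [abs_mul, abs_of_nonneg (by positivity : (0 : ℝ) ≤ 1 / N)]
      refine mul_le_mul_of_nonneg_left ((Finset.abs_sum_le_sum_abs _ _).trans
        (Finset.sum_le_sum fun i _ => ?_)) (by positivity)
      have young : ∀ y z : ℝ, |y * z| ≤ n / 2 * y ^ 2 + (1 / (2 * n)) * z ^ 2 := fun y z => by
        have e : n / 2 * y ^ 2 + (1 / (2 * n)) * z ^ 2 - |y * z|
            = (n * |y| - |z|) ^ 2 / (2 * n) := by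
          rw [abs_mul, ← sq_abs y, ← sq_abs z]; field_simp; ring
        have : 0 ≤ (n * |y| - |z|) ^ 2 / (2 * n) := by positivity
        linarith
      have y1 := young (r i a x) (X i b x)
      have y2 := young (r i b x) (X i a x)
      have y3 : |r i a x * r i b x| ≤ n / 2 * r i a x ^ 2 + n / 2 * r i b x ^ 2 := by
        have h1 : |r i a x * r i b x| ≤ 1 / 2 * (r i a x ^ 2 + r i b x ^ 2) := by
          rw [abs_mul, ← sq_abs (r i a x), ← sq_abs (r i b x)]
          nlinarith [sq_nonneg (|r i a x| - |r i b x|)]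
        have h2 : 0 ≤ (n - 1) * (r i a x ^ 2 + r i b x ^ 2) :=
          mul_nonneg (by linarith) (by positivity)
        nlinarith
      have t1 := abs_add_le (r i a x * X i b x + X i a x * r i b x) (r i a x * r i b x)
      have t2 := abs_add_le (r i a x * X i b x) (X i a x * r i b x)
      rw [mul_comm (X i a x)] at t1 t2
      simp only [hG]
      rw [mul_comm (X i a x) (r i b x)]
      linarith
    calc ∫ x, |U x| ∂D.P ≤ ∫ x, (1 / (N : ℝ)) * ∑ i, G i x ∂D.P :=
          integral_mono hUi.abs ((integrable_finsetSum _ fun i _ => hGi i).const_mul _) hUG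
      _ = (1 / (N : ℝ)) * ∑ i, ∫ x, G i x ∂D.P := by
          rw [integral_const_mul, integral_finsetSum _ fun i _ => hGi i]
      _ ≤ (1 / (N : ℝ)) * ∑ i, (n * (36 * C ^ 3 * ‖L.ld i‖ ^ 2) + (1 + 256 * C ^ 7) / n) :=
          mul_le_mul_of_nonneg_left (Finset.sum_le_sum fun i _ => hGB i) (by positivity)
      _ = 36 * C ^ 3 * (∑ i, ‖L.ld i‖ ^ 2) / n + (1 + 256 * C ^ 7) / n := by
          rw [Finset.sum_add_distrib, ← Finset.mul_sum, ← Finset.mul_sum]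
          simp only [Finset.sum_const, Finset.card_univ, Fintype.card_fin, nsmul_eq_mul]
          rw [← hnn]
          field_simp
      _ ≤ 36 * C ^ 3 * C / n + (1 + 256 * C ^ 7) / n := by
          have := h.loadings
          gcongr
      _ ≤ (1 + 300 * C ^ 7) / n := by
          rw [← add_div]
          refine div_le_div_of_nonneg_right ?_ hn0.le
          have := pow_le_pow_right₀ hC (show 4 ≤ 7 by norm_num)
          nlinarith [pow_nonneg hC0 7]
  calc ∫ x, |D.covEst x a b - (1 / (N : ℝ)) * ∑ i, L.centre i x a b| ∂D.P
      = ∫ x, |U x + Y x| ∂D.P := integral_congr_ae (hdec.mono fun x hx => by simp only [hx])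
    _ ≤ ∫ x, (|U x| + |Y x|) ∂D.P :=
        integral_mono (hUi.add hYi).abs (hUi.abs.add hYi.abs) fun x => abs_add_le _ _
    _ = ∫ x, |U x| ∂D.P + ∫ x, |Y x| ∂D.P := integral_add hUi.abs hYi.abs
    _ ≤ (1 + 300 * C ^ 7) / n + (1 + 256 * C ^ 7) / n := add_le_add hUabs hYabs
    _ ≤ (2 + 1000 * C ^ 7) / n := by
        rw [← add_div]
        refine div_le_div_of_nonneg_right ?_ hn0.le
        nlinarith [pow_nonneg hC0 7]

end Panel.Regular

end Centre

/-! ### Random matrices and the limit -/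

section MatrixNorm

variable {m n : Type*} [Fintype m] [Fintype n] [DecidableEq m] [DecidableEq n]

lemma exists_abs_entry_le_norm (m n : Type*) [Fintype m] [Fintype n] [DecidableEq m]
    [DecidableEq n] : ∃ K : ℝ, ∀ (a : m) (b : n) (M : Matrix m n ℝ), |M a b| ≤ K * ‖M‖ := by
  have h : ∀ p : m × n, ∃ K : ℝ, 0 ≤ K ∧ ∀ M : Matrix m n ℝ, |M p.1 p.2| ≤ K * ‖M‖ := fun p => by
    let f : Matrix m n ℝ →L[ℝ] ℝ :=
      LinearMap.toContinuousLinearMap (Matrix.entryLinearMap ℝ ℝ p.1 p.2)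
    exact ⟨‖f‖, norm_nonneg f, fun M => f.le_opNorm M⟩
  choose K hK0 hK using h
  refine ⟨∑ p, K p, fun a b M => (hK (a, b) M).trans ?_⟩
  exact mul_le_mul_of_nonneg_right
    (Finset.single_le_sum (fun p _ => hK0 p) (Finset.mem_univ (a, b))) (norm_nonneg _)

lemma eq_sum_smul_single (M : Matrix m n ℝ) :
    M = ∑ p : m × n, M p.1 p.2 • Matrix.single p.1 p.2 (1 : ℝ) := by
  rw [Fintype.sum_prod_type]
  conv_lhs => rw [Matrix.matrix_eq_sum_single M]
  simp [Matrix.smul_single]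

lemma norm_le_sum_abs_entry (M : Matrix m n ℝ) :
    ‖M‖ ≤ ∑ p : m × n, |M p.1 p.2| * ‖(Matrix.single p.1 p.2 1 : Matrix m n ℝ)‖ := by
  conv_lhs => rw [eq_sum_smul_single M]
  refine (norm_sum_le _ _).trans (Finset.sum_le_sum fun p _ => ?_)
  rw [norm_smul, Real.norm_eq_abs]

lemma memLp_matrix {Ω : Type*} [MeasurableSpace Ω] {P : Measure Ω} {q : ENNReal}
    {M : Ω → Matrix m n ℝ} (h : ∀ a b, MemLp (fun x => M x a b) q P) : MemLp M q P := by
  have e : M = fun x => ∑ p : m × n, M x p.1 p.2 • Matrix.single p.1 p.2 (1 : ℝ) :=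
    funext fun x => eq_sum_smul_single (M x)
  rw [e]
  refine memLp_finsetSum _ fun p _ => ?_
  exact (ContinuousLinearMap.toSpanSingleton ℝ (Matrix.single p.1 p.2 (1 : ℝ))).comp_memLp'
    (h p.1 p.2)

/-- If the expected squared operator norm of a random matrix tends to zero, its entries tend to
zero in mean. -/
lemma tendsto_integral_abs_entry {ι : Type*} {l : Filter ι} {Ω : ι → Type*}
    [∀ i, MeasurableSpace (Ω i)] {P : ∀ i, Measure (Ω i)} [∀ i, IsProbabilityMeasure (P i)]
    {M : ∀ i, Ω i → Matrix m n ℝ} (hM : ∀ i a b, MemLp (fun x => M i x a b) 2 (P i))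
    (h : Tendsto (fun i => ∫ x, ‖M i x‖ ^ 2 ∂P i) l (𝓝 0)) (a : m) (b : n) :
    Tendsto (fun i => ∫ x, |M i x a b| ∂P i) l (𝓝 0) := by
  obtain ⟨K, hK⟩ := exists_abs_entry_le_norm m n
  have hlim : Tendsto (fun i => √(K ^ 2 * ∫ x, ‖M i x‖ ^ 2 ∂P i)) l (𝓝 0) := by
    have := (h.const_mul (K ^ 2)).sqrt
    simpa using this
  refine squeeze_zero (fun i => integral_nonneg fun x => abs_nonneg _) (fun i => ?_) hlim
  apply Real.le_sqrt_of_sq_le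
  have habs : MemLp (fun x => |M i x a b|) 2 (P i) := (hM i a b).abs
  have hvar := variance_nonneg (fun x => |M i x a b|) (P i)
  rw [variance_eq_sub habs] at hvar
  have hle : ∫ x, |M i x a b| ^ 2 ∂P i ≤ ∫ x, K ^ 2 * ‖M i x‖ ^ 2 ∂P i := by
    refine integral_mono habs.integrable_sq
      (((memLp_matrix (hM i)).integrable_norm_pow (by norm_num)).const_mul _) fun x => ?_
    simp only
    rw [← mul_pow]
    exact pow_le_pow_left₀ (abs_nonneg _) (hK a b _) 2
  rw [integral_const_mul] at hle
  simp only [Pi.pow_apply] at hvar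
  linarith

end MatrixNorm

section Limit

/-- If `g i → g₀` are numbers and the means of `Y i` tend to `y₀` while `Y i` minus its mean
tends to zero in mean, then `g i * Y i` tends to `g₀ * y₀` in mean. -/
lemma tendsto_integral_abs_mul_sub {ι : Type*} {l : Filter ι} {Ω : ι → Type*}
    [∀ i, MeasurableSpace (Ω i)] {P : ∀ i, Measure (Ω i)} [∀ i, IsProbabilityMeasure (P i)]
    {g : ι → ℝ} {Y : ∀ i, Ω i → ℝ} {μ : ι → ℝ} {g₀ y₀ : ℝ} (hY : ∀ i, Integrable (Y i) (P i))
    (hg : Tendsto g l (𝓝 g₀)) (hμ : Tendsto μ l (𝓝 y₀))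
    (h : Tendsto (fun i => ∫ x, |Y i x - μ i| ∂P i) l (𝓝 0)) :
    Tendsto (fun i => ∫ x, |g i * Y i x - g₀ * y₀| ∂P i) l (𝓝 0) := by
  have hlim : Tendsto (fun i => |g i| * (∫ x, |Y i x - μ i| ∂P i) + |g i * μ i - g₀ * y₀|) l
      (𝓝 0) := by
    have h1 := hg.abs.mul h
    have h2 := ((hg.mul hμ).sub_const (g₀ * y₀)).abs
    simpa using h1.add h2
  refine squeeze_zero (fun i => integral_nonneg fun x => abs_nonneg _) (fun i => ?_) hlim
  have i1 : Integrable (fun x => |Y i x - μ i|) (P i) := ((hY i).sub (integrable_const _)).abs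
  have i2 : Integrable (fun x => |g i| * |Y i x - μ i|) (P i) := i1.const_mul _
  have i3 : Integrable (fun x => |g i * Y i x - g₀ * y₀|) (P i) :=
    (((hY i).const_mul (g i)).sub (integrable_const (g₀ * y₀))).abs
  calc ∫ x, |g i * Y i x - g₀ * y₀| ∂P i
      ≤ ∫ x, (|g i| * |Y i x - μ i| + |g i * μ i - g₀ * y₀|) ∂P i := by
        refine integral_mono i3 (i2.add (integrable_const _)) fun x => ?_
        simp only
        rw [← abs_mul]
        refine le_trans (le_of_eq ?_) (abs_add_le _ _)
        congr 1; ring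
    _ = _ := by
        rw [integral_add i2 (integrable_const _), integral_const_mul]
        simp

variable {kv kw kγ kf : ℕ}

lemma tendsto_integral_abs_centre_sub {D : ∀ N T : ℕ, Panel N T kv kw kγ}
    {L : ∀ N T : ℕ, Latent (D N T) kf}
    {Ωv : Matrix (Fin kv) (Fin kv) ℝ} {Ωw : Matrix (Fin kw) (Fin kw) ℝ}
    {Γπγ : Matrix (Fin kf) (Fin kγ) ℝ} {Γω : Matrix (Fin kγ) (Fin kγ) ℝ} {ω : ℝ}
    {Sfv : Matrix (Fin kf × Fin kv) (Fin kf × Fin kv) ℝ} {C : ℝ}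
    (hreg : ∀ N T, (D N T).Regular (L N T) C) (hcommon : CommonVariables D Ωv Ωw)
    (hfactor : WeakFactorStructure D L Γπγ Γω ω Sfv) (horth : Γπγ = 0)
    (a b : (Fin kγ × Fin kv) ⊕ Fin kw) :
    Tendsto (fun n : ℕ × ℕ => ∫ x, |(1 / (n.1 : ℝ)) * ∑ i, (L n.1 n.2).centre i x a b
      - sigmaXi Γπγ Sfv Γω Ωv ω Ωw a b| ∂(D n.1 n.2).P) (atTop ×ˢ atTop) (𝓝 0) := by
  have entry : ∀ {m' n' : Type} [Fintype m'] [Fintype n'] [DecidableEq m'] [DecidableEq n']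
      {M : ℕ × ℕ → Matrix m' n' ℝ} {A : Matrix m' n' ℝ} (a : m') (b : n'),
      Tendsto M (atTop ×ˢ atTop) (𝓝 A) →
      Tendsto (fun n => M n a b) (atTop ×ˢ atTop) (𝓝 (A a b)) := fun a b hM =>
    ((continuous_id.matrix_elem a b).tendsto _).comp hM
  rcases a with ⟨p, q⟩ | j <;> rcases b with ⟨p', q'⟩ | j'
  · have hS : sigmaXi Γπγ Sfv Γω Ωv ω Ωw (Sum.inl (p, q)) (Sum.inl (p', q'))
        = Γω p p' * Ωv q q' := by
      simp [sigmaXi, sigmaV, horth]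
    have e : ∀ (n : ℕ × ℕ) (x : (D n.1 n.2).Ω), (1 / (n.1 : ℝ)) *
        ∑ i, (L n.1 n.2).centre i x (Sum.inl (p, q)) (Sum.inl (p', q'))
        = ((1 / (n.1 : ℝ)) • ∑ i, (L n.1 n.2).σ i ^ 2 • outer ((D n.1 n.2).γ i)) p p'
          * (D n.1 n.2).avgV x q q' := fun n x => by
      simp [Latent.centre, Matrix.sum_apply, Finset.sum_mul, Finset.mul_sum, mul_assoc]
    simp_rw [e, hS]
    refine tendsto_integral_abs_mul_sub
      (μ := fun n => expMat (D n.1 n.2).P (D n.1 n.2).avgV q q')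
      (fun n => ((hreg n.1 n.2).avgV_regular q q').2.integrable (by norm_num))
      (entry p p' hfactor.lim_weighted) (entry q q' hcommon.mean_v) ?_
    exact tendsto_integral_abs_entry (fun n c d =>
      ((hreg n.1 n.2).avgV_regular c d).2.sub (memLp_const _)) hcommon.lln_v q q'
  · simp [Latent.centre, sigmaXi]
  · simp [Latent.centre, sigmaXi]
  · have hS : sigmaXi Γπγ Sfv Γω Ωv ω Ωw (Sum.inr j) (Sum.inr j') = ω ^ 4 * Ωw j j' := by
      simp [sigmaXi]
    have e : ∀ (n : ℕ × ℕ) (x : (D n.1 n.2).Ω), (1 / (n.1 : ℝ)) *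
        ∑ i, (L n.1 n.2).centre i x (Sum.inr j) (Sum.inr j')
        = ((1 / (n.1 : ℝ)) * ∑ i, (L n.1 n.2).σ i ^ 4) * (D n.1 n.2).avgW x j j' := fun n x => by
      simp [Latent.centre, ← Finset.sum_mul, mul_assoc]
    simp_rw [e, hS]
    refine tendsto_integral_abs_mul_sub
      (μ := fun n => expMat (D n.1 n.2).P (D n.1 n.2).avgW j j')
      (fun n => ((hreg n.1 n.2).avgW_regular j j').2.integrable (by norm_num))
      hfactor.lim_fourth (entry j j' hcommon.mean_w) ?_
    exact tendsto_integral_abs_entry (fun n c d =>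
      ((hreg n.1 n.2).avgW_regular c d).2.sub (memLp_const _)) hcommon.lln_w j j'

end Limit

theorem theorem4 {kv kw kγ kf : ℕ}
    (D : ∀ N T : ℕ, Panel N T kv kw kγ) (L : ∀ N T : ℕ, Latent (D N T) kf)
    (Ωv : Matrix (Fin kv) (Fin kv) ℝ) (Ωw : Matrix (Fin kw) (Fin kw) ℝ)
    (Γπγ : Matrix (Fin kf) (Fin kγ) ℝ) (Γω : Matrix (Fin kγ) (Fin kγ) ℝ) (ω : ℝ)
    (Sfv : Matrix (Fin kf × Fin kv) (Fin kf × Fin kv) ℝ)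
    (hcommon : CommonVariables D Ωv Ωw)
    (hweights : BoundedWeights D)
    (herrors : ErrorConditions D)
    (hfactor : WeakFactorStructure D L Γπγ Γω ω Sfv)
    (horth : Γπγ = 0) :
    TendstoInProbability D (fun N T => (D N T).covEst) (sigmaXi Γπγ Sfv Γω Ωv ω Ωw) := by
  obtain ⟨C, hreg⟩ := exists_regular D L hcommon hweights hfactor
  set A := sigmaXi Γπγ Sfv Γω Ωv ω Ωw with hA
  have hcentre : ∀ (n : ℕ × ℕ) a b, Integrable
      (fun x => (1 / (n.1 : ℝ)) * ∑ i, (L n.1 n.2).centre i x a b - A a b) (D n.1 n.2).P :=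
    fun n a b => ((integrable_finsetSum _ fun i _ =>
      ((hreg n.1 n.2).centre_regular i a b).2.integrable (by norm_num)).const_mul _).sub
        (integrable_const _)
  have hsub : ∀ n : ℕ × ℕ, 0 < n.1 → ∀ a b, Integrable
      (fun x => (D n.1 n.2).covEst x a b - A a b) (D n.1 n.2).P := fun n hn a b => by
    have := ((hreg n.1 n.2).integral_abs_covEst_sub_le hn a b).1.add (hcentre n a b)
    refine this.congr (Eventually.of_forall fun x => ?_)
    simp
  have hpos : ∀ᶠ n : ℕ × ℕ in atTop ×ˢ atTop, 0 < n.1 :=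
    tendsto_fst.eventually (eventually_gt_atTop 0)
  -- convergence in mean of every entry
  have hL1 : ∀ a b, Tendsto (fun n : ℕ × ℕ =>
      ∫ x, |(D n.1 n.2).covEst x a b - A a b| ∂(D n.1 n.2).P) (atTop ×ˢ atTop) (𝓝 0) := by
    intro a b
    have h1 : Tendsto (fun n : ℕ × ℕ => (2 + 1000 * C ^ 7) / √(n.1 : ℝ))
        (atTop ×ˢ atTop) (𝓝 0) :=
      (tendsto_const_nhds.div_atTop (Real.tendsto_sqrt_atTop.comp
        tendsto_natCast_atTop_atTop)).comp tendsto_fst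
    have h2 := tendsto_integral_abs_centre_sub hreg hcommon hfactor horth a b
    have h3 := h1.add h2
    rw [add_zero] at h3
    refine squeeze_zero' (Eventually.of_forall fun n => integral_nonneg fun x => abs_nonneg _)
      (hpos.mono fun n hn => ?_) h3
    obtain ⟨hi, hle⟩ := (hreg n.1 n.2).integral_abs_covEst_sub_le hn a b
    calc ∫ x, |(D n.1 n.2).covEst x a b - A a b| ∂(D n.1 n.2).P
        ≤ ∫ x, (|(D n.1 n.2).covEst x a b - (1 / (n.1 : ℝ)) * ∑ i, (L n.1 n.2).centre i x a b|
          + |(1 / (n.1 : ℝ)) * ∑ i, (L n.1 n.2).centre i x a b - A a b|) ∂(D n.1 n.2).P := by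
          refine integral_mono (hsub n hn a b).abs (hi.abs.add (hcentre n a b).abs) fun x => ?_
          exact abs_sub_le _ _ _
      _ ≤ _ := by
          rw [integral_add hi.abs (hcentre n a b).abs]
          exact add_le_add_left hle _
  -- Markov's inequality for a weighted sum of the entries that dominates the operator norm
  intro ε hε
  set κ : ((Fin kγ × Fin kv) ⊕ Fin kw) × ((Fin kγ × Fin kv) ⊕ Fin kw) → ℝ := fun p =>
    ‖(Matrix.single p.1 p.2 1 :
      Matrix ((Fin kγ × Fin kv) ⊕ Fin kw) ((Fin kγ × Fin kv) ⊕ Fin kw) ℝ)‖ with hκ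
  have hlim : Tendsto (fun n : ℕ × ℕ => ENNReal.ofReal ((∑ p, (∫ x,
      |(D n.1 n.2).covEst x p.1 p.2 - A p.1 p.2| ∂(D n.1 n.2).P) * κ p) / ε))
      (atTop ×ˢ atTop) (𝓝 0) := by
    have h1 := (tendsto_finsetSum Finset.univ fun p _ =>
      (hL1 p.1 p.2).mul_const (κ p)).div_const ε
    simp only [zero_mul, Finset.sum_const_zero, zero_div] at h1
    simpa using ENNReal.tendsto_ofReal h1
  refine tendsto_of_tendsto_of_tendsto_of_le_of_le' tendsto_const_nhds hlim
    (Eventually.of_forall fun n => bot_le) (hpos.mono fun n hn => ?_)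
  set W : (D n.1 n.2).Ω → ℝ := fun x => ∑ p, |(D n.1 n.2).covEst x p.1 p.2 - A p.1 p.2| * κ p
    with hW
  have hWi : Integrable W (D n.1 n.2).P :=
    integrable_finsetSum _ fun p _ => (hsub n hn p.1 p.2).abs.mul_const _
  have hW0 : ∀ x, 0 ≤ W x := fun x => Finset.sum_nonneg fun p _ => by positivity
  have hmarkov := mul_meas_ge_le_integral_of_nonneg (Eventually.of_forall hW0) hWi ε
  have hWint : ∫ x, W x ∂(D n.1 n.2).P = ∑ p, (∫ x,
      |(D n.1 n.2).covEst x p.1 p.2 - A p.1 p.2| ∂(D n.1 n.2).P) * κ p := by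
    rw [hW, integral_finsetSum _ fun p _ => (hsub n hn p.1 p.2).abs.mul_const _]
    exact Finset.sum_congr rfl fun p _ => integral_mul_const _ _
  have hmono : (D n.1 n.2).P {x | ε ≤ ‖(D n.1 n.2).covEst x - A‖}
      ≤ (D n.1 n.2).P {x | ε ≤ W x} :=
    measure_mono fun x hx => le_trans hx (norm_le_sum_abs_entry _)
  refine hmono.trans ?_
  rw [← ofReal_measureReal]
  refine ENNReal.ofReal_le_ofReal ?_
  rw [le_div_iff₀ hε, ← hWint, mul_comm]
  exact hmarkov
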